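/- Let $d\ge 2$, let $\mathbb T^{d-1}$ be the unit torus, $\Omega=(-1,1)\times\mathbb T^{d-1}$, $\overline\Omega=[-1,1]\times\mathbb T^{d-1}$ and $\Gamma=\{-1,1\}\times\mathbb T^{d-1}$, with outward unit normal $\mathbf n$, $\mathbf n_1=\pm1$ on $\{\pm1\}\times\mathbb T^{d-1}$. Let $a>-1/2$, $\varphi(r)=r(1+ar)$, and let $b:\Gamma\to(0,1)$ be the restriction to $\Gamma$ of a $C^2$ function $\beta$ defined on an open neighbourhood of $\overline\Omega$ and satisfying $c\le\beta\le C$ for some constants $0<c\le C<1$. For $T>0$ let $\mathcal C^{1,2}_0(\overline{\Omega_T})$ be the set of functions $G=G_t(u):[0,T]\times\overline\Omega\to\mathbb R$ with one continuous derivative in time and two continuous derivatives in space, all continuous up to the boundary, which vanish on $[0,T]\times\Gamma$. Given a measurable $\rho_0:\Omega\to[0,1]$, a measurable function $\rho:[0,T]\times\overline\Omega\to[0,1]$ is a weak solution of $$\partial_t\rho=\Delta\varphi(\rho),\qquad \rho(0,\cdot)=\rho_0,\qquad \rho(t,\cdot)|_\Gamma=b$$ in the layer $[0,T]\times\Omega$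 if $\rho\in L^2([0,T],H^1(\Omega))$ and, for every $G\in\mathcal C^{1,2}_0(\overline{\Omega_T})$, $$\int_\Omega \{G_T(u)\rho(T,u)-G_0(u)\rho_0(u)\}\,du-\int_0^T\!ds\int_\Omega(\partial_sG_s)(u)\,\rho(s,u)\,du=\int_0^T\!ds\int_\Omega(\Delta G_s)(u)\,\varphi(\rho(s,u))\,du-\int_0^T\!ds\int_\Gamma\varphi(b(u))\,\mathbf n_1(u)\,(\partial_{u_1}G_s)(u)\,dS.$$ For $T\in(0,\infty]$, call $\rho$ a weak solution up to time $T$ with initial condition $\rho_0$ if $\rho(0,\cdot)=\rho_0$ almost everywhere in $\Omega$ and $\rho$ is a weak solution in the layer $[0,T']\times\Omega$ for every finite $T'$ with $0<T'\le T$ (for $T=\infty$ this is a weak solution on $[0,\infty)$). **Lemma.** Let $T\in(0,\infty]$, let $\rho^1_0,\rho^2_0:\Omega\to[0,1]$ be measurable, and let $\rho^1,\rho^2$ be weak solutions up to time $T$, with the same boundary data $b$ and initial conditions $\rho^1_0,\rho^2_0$. If for some finite $s\ge0$ one has $\rho^1(s,u)\le\rho^2(s,u)$ for Lebesgue-almost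 every $u\in\Omega$, then for every finite $t$ with $s\le t\le T$ one has $\rho^1(t,u)\le\rho^2(t,u)$ for Lebesgue-almost every $u\in\Omega$. In particular, for $T=\infty$ this holds for all $t\ge s$. -/

import Mathlib

/-!
The spatial domain is a bounded cylinder in `ℝ × 𝕋^n`, where `𝕋^n` is the `n`-dimensional unit
torus; its dimension is `d = n + 1`. A point is `u = (u₁, ǔ)` with `u₁ : ℝ` and `ǔ : 𝕋^n`.
Functions on subsets of the cylinder are total functions of which only the values on the relevant
subset are ever used.
-/

open MeasureTheory

namespace Exclusion

noncomputable section

/-- The unbounded cylinder `ℝ × 𝕋^n`, with its product topology, group structure and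
Lebesgue (Haar) measure; the torus has total mass one. -/
abbrev Cyl (n : ℕ) : Type := ℝ × UnitAddTorus (Fin n)

/-- The open set `Ω = (-1, 1) × 𝕋^n`. -/
def Omega (n : ℕ) : Set (Cyl n) := {u | u.1 ∈ Set.Ioo (-1 : ℝ) 1}

/-- The closure `[-1, 1] × 𝕋^n` of `Ω`. -/
def OmegaBar (n : ℕ) : Set (Cyl n) := {u | u.1 ∈ Set.Icc (-1 : ℝ) 1}

/-- The boundary `Γ = {-1, 1} × 𝕋^n` of `Ω`. -/
def Gam (n : ℕ) : Set (Cyl n) := {u | u.1 = -1 ∨ u.1 = 1}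

/-- The covering map `ℝ × ℝ^n → ℝ × 𝕋^n`. -/
def cover (n : ℕ) (x : ℝ × (Fin n → ℝ)) : Cyl n := (x.1, fun j => (x.2 j : UnitAddCircle))

/-- The translation `h e_i`, for `e_0, …, e_n` the coordinate directions of `ℝ × 𝕋^n`
(`i = 0` is the direction of the axis of the cylinder). -/
def shift {n : ℕ} (i : Fin (n + 1)) (h : ℝ) : Cyl n :=
  Fin.cases (motive := fun _ => Cyl n) (h, 0) (fun j => (0, Pi.single j (h : UnitAddCircle))) i

/-- The values of `h` for which `u + h e_i` belongs to the closed cylinder. -/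
def lineSet {n : ℕ} (i : Fin (n + 1)) (u : Cyl n) : Set ℝ := {h | u + shift i h ∈ OmegaBar n}

/-- `f` has a partial derivative in direction `e_i` at every point of the closed cylinder
(one-sided in the axial direction at the boundary). -/
def HasPartial {n : ℕ} (i : Fin (n + 1)) (f : Cyl n → ℝ) : Prop :=
  ∀ u ∈ OmegaBar n, DifferentiableWithinAt ℝ (fun h => f (u + shift i h)) (lineSet i u) 0

/-- The partial derivative `∂_{u_i} f` (one-sided in the axial direction at the boundary). -/
def partialD {n : ℕ} (i : Fin (n + 1)) (f : Cyl n → ℝ) (u : Cyl n) : ℝ :=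
  derivWithin (fun h => f (u + shift i h)) (lineSet i u) 0

/-- The Laplacian `Δ f = ∑ i, ∂_{u_i}² f`. -/
def laplacian {n : ℕ} (f : Cyl n → ℝ) (u : Cyl n) : ℝ :=
  ∑ i : Fin (n + 1), partialD i (partialD i f) u

/-- The time derivative of `G` on `[0, T]` (one-sided at the end points). -/
def timeD {n : ℕ} (T : ℝ) (G : ℝ → Cyl n → ℝ) (t : ℝ) (u : Cyl n) : ℝ :=
  derivWithin (fun r => G r u) (Set.Icc 0 T) t

/-- Continuity on `[0, T] × closure Ω`. -/
def ContBar {n : ℕ} (T : ℝ) (G : ℝ → Cyl n → ℝ) : Prop :=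
  ContinuousOn (fun p : ℝ × Cyl n => G p.1 p.2) (Set.Icc 0 T ×ˢ OmegaBar n)

/-- The space `C₀^{1,2}` of functions on `[0, T] × closure Ω` with one continuous derivative in time
and two continuous derivatives in space (all continuous up to the boundary), vanishing on
`[0, T] × Γ`. -/
structure IsTest {n : ℕ} (T : ℝ) (G : ℝ → Cyl n → ℝ) : Prop where
  cont : ContBar T G
  time_diff : ∀ u ∈ OmegaBar n, DifferentiableOn ℝ (fun t => G t u) (Set.Icc 0 T)
  time_cont : ContBar T (timeD T G)
  space_diff : ∀ i, ∀ t ∈ Set.Icc 0 T, HasPartial i (G t)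
  space_cont : ∀ i, ContBar T (fun t => partialD i (G t))
  space_diff₂ : ∀ i j, ∀ t ∈ Set.Icc 0 T, HasPartial i (partialD j (G t))
  space_cont₂ : ∀ i j, ContBar T (fun t => partialD i (partialD j (G t)))
  boundary : ∀ t ∈ Set.Icc 0 T, ∀ u ∈ Gam n, G t u = 0

/-- Smooth functions with compact support in the open set `Ω`. -/
structure IsSmoothCompact {n : ℕ} (f : Cyl n → ℝ) : Prop where
  smooth : ContDiff ℝ ((⊤ : ℕ∞) : WithTop ℕ∞) (f ∘ cover n)
  compact : HasCompactSupport f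
  support : tsupport f ⊆ Omega n

/-- `f` belongs to the Sobolev space `H¹(Ω)` and `g` is its generalized gradient. -/
structure HasWeakGradient {n : ℕ} (f : Cyl n → ℝ) (g : Cyl n → EuclideanSpace ℝ (Fin (n + 1))) :
    Prop where
  memLp : MemLp f 2 (volume.restrict (Omega n))
  memLp_grad : MemLp g 2 (volume.restrict (Omega n))
  parts : ∀ w : Cyl n → ℝ, IsSmoothCompact w → ∀ i,
    ∫ u in Omega n, f u * partialD i w u = -∫ u in Omega n, g u i * w u

/-- The flux function `φ(r) = r (1 + a r)`. -/
def phi (a r : ℝ) : ℝ := r * (1 + a * r)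

/-- Admissible boundary densities: `b` is the restriction to `Γ` of a `C²` function on a
neighbourhood `V` of the closed cylinder, bounded away from `0` and from `1`. -/
def IsBoundaryDensity {n : ℕ} (b : Cyl n → ℝ) : Prop :=
  ∃ (V : Set (Cyl n)) (β : Cyl n → ℝ) (c C : ℝ),
    IsOpen V ∧ OmegaBar n ⊆ V ∧ ContDiffOn ℝ 2 (β ∘ cover n) (cover n ⁻¹' V) ∧
    0 < c ∧ C < 1 ∧ (∀ u ∈ V, β u ∈ Set.Icc c C) ∧ ∀ u ∈ Gam n, β u = b u

/-- Measurable profiles `Ω → [0, 1]`. -/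
structure IsProfile {n : ℕ} (ρ₀ : Cyl n → ℝ) : Prop where
  meas : Measurable ((Omega n).domRestrict ρ₀)
  range : ∀ u ∈ Omega n, ρ₀ u ∈ Set.Icc (0 : ℝ) 1

/-- The surface integral `∫_Γ φ(b) 𝐧₁ (∂_{u₁} f) dS`; the outward normal satisfies `𝐧₁ = ±1` on
`{±1} × 𝕋^n`. -/
def boundaryFlux {n : ℕ} (a : ℝ) (b f : Cyl n → ℝ) : ℝ :=
  (∫ v : UnitAddTorus (Fin n), phi a (b (1, v)) * partialD 0 f (1, v)) -
    ∫ v : UnitAddTorus (Fin n), phi a (b (-1, v)) * partialD 0 f (-1, v)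

/-- `ρ` is a weak solution of `∂_t ρ = Δ φ(ρ)`, `ρ(0, ·) = ρ₀`, `ρ(t, ·)|_Γ = b` in the layer
`[0, T] × Ω`: a measurable function `[0, T] × closure Ω → [0, 1]` in `L²([0, T], H¹(Ω))` that
satisfies the integrated equation for every test function. -/
structure IsWeakSolutionLayer {n : ℕ} (a : ℝ) (b ρ₀ : Cyl n → ℝ) (T : ℝ) (ρ : ℝ → Cyl n → ℝ) :
    Prop where
  meas : Measurable
    ((Set.Icc 0 T ×ˢ OmegaBar n).domRestrict (fun p : ℝ × Cyl n => ρ p.1 p.2))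
  range : ∀ t ∈ Set.Icc 0 T, ∀ u ∈ OmegaBar n, ρ t u ∈ Set.Icc (0 : ℝ) 1
  energy : ∃ g : ℝ → Cyl n → EuclideanSpace ℝ (Fin (n + 1)),
    Measurable (fun p : ℝ × Cyl n => g p.1 p.2) ∧
    (∀ᵐ s ∂(volume.restrict (Set.Icc 0 T)), HasWeakGradient (ρ s) (g s)) ∧
    ∫⁻ s in Set.Icc 0 T, ∫⁻ u in Omega n, ‖g s u‖ₑ ^ 2 < ⊤
  weak : ∀ G : ℝ → Cyl n → ℝ, IsTest T G →
    (∫ u in Omega n, (G T u * ρ T u - G 0 u * ρ₀ u)) -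
        ∫ s in (0 : ℝ)..T, ∫ u in Omega n, timeD T G s u * ρ s u =
      (∫ s in (0 : ℝ)..T, ∫ u in Omega n, laplacian (G s) u * phi a (ρ s u)) -
        ∫ s in (0 : ℝ)..T, boundaryFlux a b (G s)

/-- `ρ` is a weak solution up to the time horizon `T ∈ (0, ∞]`: it takes the initial value `ρ₀`
and it is a weak solution in the layer `[0, T'] × Ω` for every finite `0 < T' ≤ T`. For `T = ∞`
this is a global weak solution. -/
structure IsWeakSolution {n : ℕ} (a : ℝ) (b ρ₀ : Cyl n → ℝ) (T : EReal) (ρ : ℝ → Cyl n → ℝ) :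
    Prop where
  initial : ∀ᵐ u ∂(volume.restrict (Omega n)), ρ 0 u = ρ₀ u
  layer : ∀ T' : ℝ, 0 < T' → (T' : EReal) ≤ T → IsWeakSolutionLayer a b ρ₀ T' ρ

end

end Exclusion

namespace Exclusion

open MeasureTheory Set Filter Topology
open scoped ENNReal

noncomputable section

/-! Put w = ρ¹ - ρ² and v = 1 + a(ρ¹ + ρ²). Since φ(ρ¹) - φ(ρ²) = v w and both solutions carry the
same boundary flux, w solves the linear problem ∂_t w = Δ(v w) with zero Dirichlet data, and a >
-1/2 confines v between two positive constants. The claim is that w ≤ 0 propagates in time. Testing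
with the Dirichlet eigenfunctions sin(πk(x+1)/2) e^{-2πi m·y} gives the scalar identities ŵ_i(r) =
ŵ_i(s) - λ_i ∫ (v w)^_i, and nothing else of the weak formulation is needed
(`IsWeakSolution.mode_equation`).

As v is merely bounded and measurable, the maximum principle is obtained by approximation. Replace Δ
by the bounded operator A_κ consisting of the Yosida approximation κ⁴(κ² - ∂²)⁻¹ - κ² in the axial
variable and second differences of step 1/κ along the torus. It is diagonal in the same modes, with
symbol -a_i where a_i ≤ λ_i and a_i → λ_i (`coef_apxLap`, `apxSymb_le`, `tendsto_apxSymb`), and it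
is a positive operator minus a multiple of the identity. Hence p' = A_κ(v p), p(s) = min(w(s), 0),
is solvable by Picard iteration and keeps p ≤ 0 (`exists_nonpos_apxLap_evolution`).

Let d = p - w and δ_i = 1 - a_i/λ_i for k ≠ 0. Then d̂_i + δ_i ŵ_i has derivative -a_i (v d)^_i. The
energy identity divided by a_i ≥ 1/2, Young's inequality and Parseval give ∫∫ v d² ≤ ∑ δ_i² g_i with
g summable and independent of κ (`mode_energy_estimate`); the right side tends to 0 by dominated
convergence. Since p ≤ 0 implies (w⁺)² ≤ d², w ≤ 0 almost everywhere in space-time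
(`ae_layer_nonpos`). Finally the mode coefficients are continuous in time, so the sign passes to the
prescribed time t as a weak limit (`ae_nonpos_of_frequently`). -/

/-! ### Parseval identities on the interval and on the torus -/

/-- The axial sine modes, which vanish at `x = ±1`. -/
def axMode (k : ℤ) (x : ℝ) : ℝ := Real.sin (Real.pi * k * (x + 1) / 2)

lemma continuous_axMode (k : ℤ) : Continuous (axMode k) := by
  unfold axMode; fun_prop

lemma abs_axMode_le (k : ℤ) (x : ℝ) : |axMode k x| ≤ 1 := Real.abs_sin_le_one _

/-- Parseval's identity for the sine series on `(-1, 1)`. -/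
lemma tsum_axMode_sq {F : ℝ → ℂ} (hF : Measurable F) {C : ℝ} (hC : ∀ x, ‖F x‖ ≤ C) :
    ∑' k : ℤ, ‖∫ x in Ioo (-1 : ℝ) 1, F x * axMode k x‖ₑ ^ 2 =
      2 * ∫⁻ x in Ioo (-1 : ℝ) 1, ‖F x‖ₑ ^ 2 := by
  have hab : (-1 : ℝ) < 3 := by norm_num
  -- The odd reflection of F about x = 1 to (-1, 3). Its Fourier coefficients for period 4 are, up
  -- to a unimodular factor, half the sine integrals of F. The index runs over all of ℤ, so every
  -- sine is counted twice; hence the factor 2 in the statement.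
  set E : ℝ → ℂ := fun x => if x ≤ 1 then F x else -F (2 - x) with hE
  have hEm : Measurable E :=
    Measurable.ite measurableSet_Iic hF (hF.comp (measurable_const.sub measurable_id)).neg
  have hEb : ∀ x, ‖E x‖ ≤ C := by
    intro x; simp only [hE]; split_ifs
    · exact hC x
    · rw [norm_neg]; exact hC _
  have hint : ∀ (G : ℝ → ℂ) (K : ℝ), Measurable G → (∀ x, ‖G x‖ ≤ K) → ∀ a b : ℝ,
      IntervalIntegrable G volume a b := by
    intro G K hG hK a b
    exact (intervalIntegrable_const (c := K)).mono_fun hG.aestronglyMeasurable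
      (Eventually.of_forall fun x => (hK x).trans (le_abs_self K))
  have hL2 : MemLp E 2 (volume.restrict (Ioc (-1 : ℝ) 3)) :=
    MemLp.of_bound hEm.aestronglyMeasurable C (Eventually.of_forall hEb)
  have key := hasSum_sq_fourierCoeffOn hab hL2
  have hsplit : ∀ (G : ℝ → ℂ), (∀ a b : ℝ, IntervalIntegrable G volume a b) →
      ∫ x in (-1 : ℝ)..3, G x = ∫ x in (-1 : ℝ)..1, (G x + G (2 - x)) := by
    intro G hG
    have h1 : IntervalIntegrable (fun x => G (2 - x)) volume (-1) 1 := by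
      simpa using (hG (2 - (-1)) (2 - 1)).comp_sub_left 2
    rw [intervalIntegral.integral_add (hG _ _) h1, intervalIntegral.integral_comp_sub_left G 2,
      ← intervalIntegral.integral_add_adjacent_intervals (hG (-1) 1) (hG 1 3)]
    norm_num
  have hcoef : ∀ k : ℤ, ‖fourierCoeffOn hab E k‖ =
      (1 / 2) * ‖∫ x in Ioo (-1 : ℝ) 1, F x * axMode k x‖ := by
    intro k
    rw [fourierCoeffOn_eq_integral, hsplit]
    · have h1 : ∫ x in (-1 : ℝ)..1, ((fourier (-k) (x : AddCircle (3 - (-1 : ℝ)))) • E x +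
          (fourier (-k) (((2 - x : ℝ)) : AddCircle (3 - (-1 : ℝ)))) • E (2 - x)) =
          ∫ x in (-1 : ℝ)..1, (Complex.exp (Real.pi * k / 2 * Complex.I) * (-2 * Complex.I)) *
            (F x * axMode k x) := by
        refine intervalIntegral.integral_congr_ae ?_
        have h1ne : ∀ᵐ x : ℝ, x ≠ 1 := by simp [ae_iff]
        filter_upwards [h1ne] with x hx1 hx
        rw [uIoc_of_le (by norm_num)] at hx
        have hx' : x < 1 := lt_of_le_of_ne hx.2 hx1
        have e1 : E x = F x := by simp [hE, hx.2]
        have e2 : E (2 - x) = -F x := by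
          simp only [hE]; rw [if_neg (by linarith)]; simp
        rw [e1, e2, fourier_coe_apply, fourier_coe_apply, axMode]
        have t1 : Complex.exp (2 * Real.pi * Complex.I * ((-k : ℤ) : ℂ) * x / ((3 - (-1 : ℝ) : ℝ) : ℂ)) =
            Complex.exp (Real.pi * k / 2 * Complex.I) *
              Complex.exp (-((Real.pi * k * (x + 1) / 2 : ℝ) : ℂ) * Complex.I) := by
          rw [← Complex.exp_add]; congr 1; push_cast; ring
        have t2 : Complex.exp (2 * Real.pi * Complex.I * ((-k : ℤ) : ℂ) * ((2 - x : ℝ) : ℂ) /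
            ((3 - (-1 : ℝ) : ℝ) : ℂ)) =
            Complex.exp (Real.pi * k / 2 * Complex.I) *
              Complex.exp (((Real.pi * k * (x + 1) / 2 : ℝ) : ℂ) * Complex.I) := by
          rw [← Complex.exp_add, Complex.exp_eq_exp_iff_exists_int]
          -- The two exponents differ by -2πik.
          refine ⟨-k, ?_⟩
          push_cast; ring
        rw [t1, t2, Complex.ofReal_sin, Complex.sin]
        simp only [smul_eq_mul]
        have : Complex.I * Complex.I = -1 := Complex.I_mul_I
        linear_combination (Complex.exp (Real.pi * k / 2 * Complex.I) * F x *
          (Complex.exp (-((Real.pi * k * (x + 1) / 2 : ℝ) : ℂ) * Complex.I) -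
          Complex.exp (((Real.pi * k * (x + 1) / 2 : ℝ) : ℂ) * Complex.I))) * this
      rw [h1, intervalIntegral.integral_const_mul, norm_smul, norm_mul, norm_mul,
        show (Real.pi * k / 2 * Complex.I : ℂ) = ((Real.pi * k / 2 : ℝ) : ℂ) * Complex.I by
          push_cast; ring, Complex.norm_exp_ofReal_mul_I,
        intervalIntegral.integral_of_le (by norm_num), integral_Ioc_eq_integral_Ioo]
      norm_num
      ring
    · refine hint _ C ?_ ?_
      · exact (((fourier (-k)).continuous.comp (AddCircle.continuous_mk' _)).measurable).mul hEm
      · intro x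
        rw [norm_smul, fourier_apply, Circle.norm_coe, one_mul]; exact hEb x
  have hnorm : ∫ x in (-1 : ℝ)..3, ‖E x‖ ^ 2 = 2 * ∫ x in Ioo (-1 : ℝ) 1, ‖F x‖ ^ 2 := by
    have h0 := hsplit (fun x => ((‖E x‖ ^ 2 : ℝ) : ℂ)) (hint _ (C ^ 2)
      (Complex.measurable_ofReal.comp (hEm.norm.pow_const 2)) (fun x => by
        rw [Complex.norm_real, norm_pow, norm_norm]; gcongr; exact hEb x))
    have h1 : ∫ x in (-1 : ℝ)..1, (((‖E x‖ ^ 2 : ℝ) : ℂ) + ((‖E (2 - x)‖ ^ 2 : ℝ) : ℂ)) =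
        ∫ x in (-1 : ℝ)..1, ((2 * ‖F x‖ ^ 2 : ℝ) : ℂ) := by
      refine intervalIntegral.integral_congr_ae ?_
      have h1ne : ∀ᵐ x : ℝ, x ≠ 1 := by simp [ae_iff]
      filter_upwards [h1ne] with x hx1 hx
      rw [uIoc_of_le (by norm_num)] at hx
      have hx' : x < 1 := lt_of_le_of_ne hx.2 hx1
      have e1 : E x = F x := by simp [hE, hx.2]
      have e2 : E (2 - x) = -F x := by
        simp only [hE]; rw [if_neg (by linarith)]; simp
      rw [e1, e2, norm_neg]; push_cast; ring
    rw [h1, intervalIntegral.integral_ofReal, intervalIntegral.integral_ofReal] at h0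
    have h2 := Complex.ofReal_injective h0
    rw [h2, intervalIntegral.integral_const_mul, intervalIntegral.integral_of_le (by norm_num),
      integral_Ioc_eq_integral_Ioo]
  simp_rw [hcoef, hnorm] at key
  have h2 : HasSum (fun k : ℤ => ‖∫ x in Ioo (-1 : ℝ) 1, F x * axMode k x‖ ^ 2)
      (2 * ∫ x in Ioo (-1 : ℝ) 1, ‖F x‖ ^ 2) := by
    have := key.mul_left 4
    rw [smul_eq_mul, show (4 : ℝ) * ((3 - -1)⁻¹ * (2 * ∫ x in Ioo (-1 : ℝ) 1, ‖F x‖ ^ 2)) =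
      2 * ∫ x in Ioo (-1 : ℝ) 1, ‖F x‖ ^ 2 by ring] at this
    refine this.congr_fun fun k => ?_
    ring
  have h3 : (2 * ∫⁻ x in Ioo (-1 : ℝ) 1, ‖F x‖ₑ ^ 2) =
      ENNReal.ofReal (2 * ∫ x in Ioo (-1 : ℝ) 1, ‖F x‖ ^ 2) := by
    rw [ENNReal.ofReal_mul (by norm_num), ofReal_integral_eq_lintegral_ofReal]
    · simp [ENNReal.ofReal_pow]
    · refine Integrable.of_bound (C := C ^ 2) (hF.norm.pow_const 2).aestronglyMeasurable
        (Eventually.of_forall fun x => ?_)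
      rw [norm_pow, norm_norm]
      gcongr; exact hC x
    · exact Eventually.of_forall fun x => by positivity
  rw [h3, ← h2.tsum_eq, ENNReal.ofReal_tsum_of_nonneg (fun k => by positivity) h2.summable]
  simp [ENNReal.ofReal_pow]

lemma torus_volume_eq {ι : Type*} [Fintype ι] :
    (volume : Measure (UnitAddTorus ι)) = Measure.pi (fun _ => AddCircle.haarAddCircle) := by
  have : (volume : Measure UnitAddCircle) = AddCircle.haarAddCircle := by
    rw [AddCircle.volume_eq_smul_haarAddCircle]; simp
  rw [volume_pi, this]

instance {ι : Type*} [Fintype ι] : IsProbabilityMeasure (volume : Measure (UnitAddTorus ι)) := by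
  rw [torus_volume_eq]; infer_instance

/-- Stated in [0, ∞], so that it combines with the axial identity by exchanging sums and integrals
without summability conditions. The frequency -m follows the convention of `mFourierCoeff`. -/
lemma tsum_mFourier_sq {ι : Type*} [Fintype ι] {f : UnitAddTorus ι → ℂ} (hf : Measurable f) {C : ℝ}
    (hC : ∀ x, ‖f x‖ ≤ C) :
    ∑' m : ι → ℤ, ‖∫ y, f y * UnitAddTorus.mFourier (-m) y‖ₑ ^ 2 = ∫⁻ y, ‖f y‖ₑ ^ 2 := by
  have hμ := torus_volume_eq (ι := ι)
  set μ : Measure (UnitAddTorus ι) := Measure.pi (fun _ => AddCircle.haarAddCircle) with hμd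
  rw [hμ]
  have hL2 : MemLp f 2 μ :=
    MemLp.of_bound hf.aestronglyMeasurable C (Eventually.of_forall hC)
  have key := UnitAddTorus.hasSum_sq_mFourierCoeff (hL2.toLp)
  have e1 : ∀ m, UnitAddTorus.mFourierCoeff (hL2.toLp f) m = ∫ y, f y * UnitAddTorus.mFourier (-m) y
      ∂μ := by
    intro m
    refine integral_congr_ae ?_
    filter_upwards [hL2.coeFn_toLp] with y hy
    rw [hy, smul_eq_mul, mul_comm]
  have e2 : (∫ y, ‖hL2.toLp f y‖ ^ 2 ∂μ) = ∫ y, ‖f y‖ ^ 2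
      ∂μ := by
    refine integral_congr_ae ?_
    filter_upwards [hL2.coeFn_toLp] with y hy
    rw [hy]
  have key2 : HasSum (fun m : ι → ℤ => ‖∫ y, f y * UnitAddTorus.mFourier (-m) y
      ∂μ‖ ^ 2)
      (∫ y, ‖f y‖ ^ 2
      ∂μ) := by
    rw [← e2]; simp_rw [← e1]; exact key
  have h3 : (∫⁻ y, ‖f y‖ₑ ^ 2 ∂μ) =
      ENNReal.ofReal (∫ y, ‖f y‖ ^ 2 ∂μ) := by
    rw [ofReal_integral_eq_lintegral_ofReal]
    · simp [ENNReal.ofReal_pow]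
    · exact hL2.integrable_norm_pow (by norm_num)
    · exact Eventually.of_forall fun x => by positivity
  rw [h3, ← key2.tsum_eq, ENNReal.ofReal_tsum_of_nonneg (fun k => by positivity) key2.summable]
  simp [ENNReal.ofReal_pow]

/-! ### Bounded measurable functions -/

/-- Bounded measurable real functions. -/
structure BddMeas {X : Type*} [MeasurableSpace X] (f : X → ℝ) : Prop where
  meas : Measurable f
  bdd : ∃ C, ∀ x, |f x| ≤ C

namespace BddMeas
variable {X Y : Type*} [MeasurableSpace X] [MeasurableSpace Y] {f g : X → ℝ}

lemma add (hf : BddMeas f) (hg : BddMeas g) : BddMeas (fun x => f x + g x) := by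
  obtain ⟨hf, C, hC⟩ := hf
  obtain ⟨hg, D, hD⟩ := hg
  exact ⟨hf.add hg, C + D, fun x => (abs_add_le _ _).trans (add_le_add (hC x) (hD x))⟩

lemma neg (hf : BddMeas f) : BddMeas (fun x => -f x) :=
  ⟨hf.meas.neg, hf.bdd.imp fun _ h x => by rw [abs_neg]; exact h x⟩

lemma sub (hf : BddMeas f) (hg : BddMeas g) : BddMeas (fun x => f x - g x) := by
  simpa only [sub_eq_add_neg] using hf.add hg.neg

lemma mul (hf : BddMeas f) (hg : BddMeas g) : BddMeas (fun x => f x * g x) := by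
  obtain ⟨hf, C, hC⟩ := hf
  obtain ⟨hg, D, hD⟩ := hg
  exact ⟨hf.mul hg, C * D, fun x => by
    rw [abs_mul]
    exact mul_le_mul (hC x) (hD x) (abs_nonneg _) ((abs_nonneg _).trans (hC x))⟩

lemma const (c : ℝ) : BddMeas (fun _ : X => c) := ⟨measurable_const, |c|, fun _ => le_rfl⟩

lemma const_mul (hf : BddMeas f) (c : ℝ) : BddMeas (fun x => c * f x) := (const c).mul hf

lemma sum {ι : Type*} (s : Finset ι) {F : ι → X → ℝ} (h : ∀ i ∈ s, BddMeas (F i)) :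
    BddMeas (fun x => ∑ i ∈ s, F i x) := by
  classical
  induction s using Finset.induction_on with
  | empty => simpa using const (X := X) 0
  | insert i s hi ih =>
    simp only [Finset.sum_insert hi]
    exact (h i (Finset.mem_insert_self _ _)).add
      (ih fun j hj => h j (Finset.mem_insert_of_mem hj))

lemma comp (hf : BddMeas f) {φ : Y → X} (hφ : Measurable φ) : BddMeas (fun y => f (φ y)) :=
  ⟨hf.meas.comp hφ, hf.bdd.imp fun _ h _ => h _⟩

lemma integrable (hf : BddMeas f) (μ : Measure X) [IsFiniteMeasure μ] : Integrable f μ := by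
  obtain ⟨hf, C, hC⟩ := hf
  exact Integrable.of_bound hf.aestronglyMeasurable C (Eventually.of_forall hC)

lemma section_right {F : X × Y → ℝ} (hF : BddMeas F) (x : X) : BddMeas (fun y => F (x, y)) :=
  hF.comp measurable_prodMk_left

end BddMeas

variable {n : ℕ}

/-! ### Dirichlet modes on the cylinder and their Parseval identities -/

/-- The eigenfunctions of the Dirichlet Laplacian on `Ω`, indexed with repetitions. -/
def mode (κ : ℤ × (Fin n → ℤ)) (u : Cyl n) : ℂ :=
  (axMode κ.1 u.1 : ℂ) * UnitAddTorus.mFourier (-κ.2) u.2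

lemma continuous_mode (κ : ℤ × (Fin n → ℤ)) : Continuous (mode κ) := by
  unfold mode
  have := continuous_axMode κ.1
  fun_prop

lemma norm_mode_le (κ : ℤ × (Fin n → ℤ)) (u : Cyl n) : ‖mode κ u‖ ≤ 1 := by
  rw [mode, norm_mul, Complex.norm_real]
  have h2 : ‖UnitAddTorus.mFourier (-κ.2) u.2‖ ≤ 1 :=
    (ContinuousMap.norm_coe_le_norm _ _).trans UnitAddTorus.mFourier_norm.le
  calc ‖axMode κ.1 u.1‖ * _ ≤ 1 * 1 :=
        mul_le_mul (abs_axMode_le _ _) h2 (norm_nonneg _) zero_le_one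
    _ = 1 := one_mul 1

/-- The coefficients of `f` with respect to the modes. -/
def coef (κ : ℤ × (Fin n → ℤ)) (f : Cyl n → ℝ) : ℂ := ∫ u in Omega n, (f u : ℂ) * mode κ u

lemma measurableSet_Omega : MeasurableSet (Omega n) := measurable_fst measurableSet_Ioo

lemma Omega_eq_prod : Omega n = Ioo (-1 : ℝ) 1 ×ˢ (univ : Set (UnitAddTorus (Fin n))) := by
  ext u; simp [Omega]

lemma restrict_Omega : (volume : Measure (Cyl n)).restrict (Omega n) =
    (volume.restrict (Ioo (-1 : ℝ) 1)).prod volume := by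
  rw [Omega_eq_prod, Measure.volume_eq_prod, ← Measure.prod_restrict, Measure.restrict_univ]

instance : IsFiniteMeasure ((volume : Measure (Cyl n)).restrict (Omega n)) := by
  rw [restrict_Omega]; infer_instance

lemma integrable_coef {f : Cyl n → ℝ} (hf : BddMeas f) (κ : ℤ × (Fin n → ℤ)) :
    Integrable (fun u => (f u : ℂ) * mode κ u) (volume.restrict (Omega n)) := by
  obtain ⟨hf, C, hC⟩ := hf
  refine Integrable.of_bound (C := C)
    ((Complex.measurable_ofReal.comp hf).mul (continuous_mode κ).measurable).aestronglyMeasurable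
    (Eventually.of_forall fun u => ?_)
  rw [norm_mul, Complex.norm_real, ← mul_one C]
  exact mul_le_mul (hC u) (norm_mode_le _ _) (norm_nonneg _) ((abs_nonneg _).trans (hC u))

lemma coef_eq_iterated {f : Cyl n → ℝ} (hf : BddMeas f) (κ : ℤ × (Fin n → ℤ)) :
    coef κ f = ∫ x in Ioo (-1 : ℝ) 1,
      (∫ y, (f (x, y) : ℂ) * UnitAddTorus.mFourier (-κ.2) y) * axMode κ.1 x := by
  have h := integrable_coef hf κ
  rw [coef]
  rw [restrict_Omega] at h ⊢
  rw [integral_prod _ h]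
  refine integral_congr_ae (Eventually.of_forall fun x => ?_)
  simp only [mode]
  rw [← integral_mul_const]
  congr 1; ext y; ring

/-- Parseval's identity on `Ω`. -/
lemma tsum_coef_sq {f : Cyl n → ℝ} (hf : BddMeas f) :
    ∑' κ : ℤ × (Fin n → ℤ), ‖coef κ f‖ₑ ^ 2 = 2 * ∫⁻ u in Omega n, ‖f u‖ₑ ^ 2 := by
  obtain ⟨C, hC⟩ := hf.bdd
  have hfm : Measurable (fun u => (f u : ℂ)) := Complex.measurable_ofReal.comp hf.meas
  have hFm : ∀ m : Fin n → ℤ, Measurable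
      (fun x : ℝ => ∫ y, (f (x, y) : ℂ) * UnitAddTorus.mFourier (-m) y) := by
    intro m
    refine (StronglyMeasurable.integral_prod_right (f := fun (x : ℝ) (y : UnitAddTorus (Fin n)) =>
      (f (x, y) : ℂ) * UnitAddTorus.mFourier (-m) y) ?_).measurable
    exact (hfm.mul ((UnitAddTorus.mFourier (-m)).continuous.measurable.comp
      measurable_snd)).stronglyMeasurable
  have hFb : ∀ (m : Fin n → ℤ) (x : ℝ),
      ‖∫ y, (f (x, y) : ℂ) * UnitAddTorus.mFourier (-m) y‖ ≤ C := by
    intro m x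
    refine (norm_integral_le_of_norm_le_const (C := C) (Eventually.of_forall fun y => ?_)).trans ?_
    · rw [norm_mul, Complex.norm_real, ← mul_one C]
      exact mul_le_mul (hC _) ((ContinuousMap.norm_coe_le_norm _ _).trans
        UnitAddTorus.mFourier_norm.le) (norm_nonneg _) ((abs_nonneg _).trans (hC (x, y)))
    · rw [probReal_univ, mul_one]
  simp_rw [coef_eq_iterated hf]
  -- For each torus frequency the axial sum is evaluated first; afterwards the sum over frequencies
  -- is evaluated for each fixed x.
  rw [ENNReal.tsum_prod', ENNReal.tsum_comm]
  have h1 := fun m => tsum_axMode_sq (hFm m) (hFb m)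
  rw [tsum_congr h1]
  rw [ENNReal.tsum_mul_left, ← lintegral_tsum (fun m => ((hFm m).enorm.pow_const 2).aemeasurable),
    restrict_Omega,
    lintegral_prod _ (by have := hf.meas; fun_prop)]
  congr 2
  ext x
  rw [tsum_mFourier_sq (f := fun y => (f (x, y) : ℂ)) (hfm.comp measurable_prodMk_left)
    (fun y => by rw [Complex.norm_real]; exact hC _)]
  congr 1; ext y
  rw [← ofReal_norm, ← ofReal_norm, Complex.norm_real]

lemma measurable_coef {F : ℝ × Cyl n → ℝ} (hF : Measurable F) (κ : ℤ × (Fin n → ℤ)) :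
    Measurable (fun r => coef κ (fun u => F (r, u))) := by
  refine (StronglyMeasurable.integral_prod_right (f := fun (r : ℝ) (u : Cyl n) =>
      (F (r, u) : ℂ) * mode κ u) ?_).measurable
  exact ((Complex.measurable_ofReal.comp hF).mul ((continuous_mode κ).measurable.comp
      measurable_snd)).stronglyMeasurable

lemma norm_coef_le {f : Cyl n → ℝ} {C : ℝ} (hC : ∀ u, |f u| ≤ C) (κ : ℤ × (Fin n → ℤ)) :
    ‖coef κ f‖ ≤ C * (volume : Measure (Cyl n)).real (Omega n) := by
  refine (norm_integral_le_of_norm_le_const (C := C) (Eventually.of_forall fun u => ?_)).trans ?_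
  · rw [norm_mul, Complex.norm_real, ← mul_one C]
    exact mul_le_mul (hC u) (norm_mode_le _ _) (norm_nonneg _) ((abs_nonneg _).trans (hC u))
  · rw [measureReal_restrict_apply_univ]

lemma coef_add {f g : Cyl n → ℝ} (hf : BddMeas f) (hg : BddMeas g) (κ : ℤ × (Fin n → ℤ)) :
    coef κ (fun u => f u + g u) = coef κ f + coef κ g := by
  rw [coef, coef, coef, ← integral_add (integrable_coef hf κ) (integrable_coef hg κ)]
  congr 1; ext u; push_cast; ring

lemma coef_const_mul (c : ℝ) (f : Cyl n → ℝ) (κ : ℤ × (Fin n → ℤ)) :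
    coef κ (fun u => c * f u) = c * coef κ f := by
  rw [coef, coef, ← integral_const_mul]
  congr 1; ext u; push_cast; ring

lemma coef_sub {f g : Cyl n → ℝ} (hf : BddMeas f) (hg : BddMeas g) (κ : ℤ × (Fin n → ℤ)) :
    coef κ (fun u => f u - g u) = coef κ f - coef κ g := by
  rw [coef, coef, coef, ← integral_sub (integrable_coef hf κ) (integrable_coef hg κ)]
  congr 1; ext u; push_cast; ring

/-- Parseval's identity on `Ω`, in real form. -/
lemma hasSum_coef_sq {f : Cyl n → ℝ} (hf : BddMeas f) :
    HasSum (fun κ : ℤ × (Fin n → ℤ) => ‖coef κ f‖ ^ 2) (2 * ∫ u in Omega n, f u ^ 2) := by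
  have hi : Integrable (fun u => f u ^ 2) (volume.restrict (Omega n)) := by
    simpa only [sq] using (hf.mul hf).integrable _
  have h := tsum_coef_sq hf
  have h3 : (2 * ∫⁻ u in Omega n, ‖f u‖ₑ ^ 2) = ENNReal.ofReal (2 * ∫ u in Omega n, f u ^ 2) := by
    rw [ENNReal.ofReal_mul (by norm_num), ofReal_integral_eq_lintegral_ofReal hi
      (Eventually.of_forall fun x => by positivity)]
    simp [← ENNReal.ofReal_pow, ← ofReal_norm]
  rw [h3] at h
  have hs : Summable (fun κ : ℤ × (Fin n → ℤ) => ‖coef κ f‖ ^ 2) := by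
    have := ENNReal.summable_toReal (h.trans_ne ENNReal.ofReal_ne_top)
    simpa using this
  rw [hs.hasSum_iff, ← ENNReal.ofReal_eq_ofReal_iff (tsum_nonneg fun κ => by positivity)
    (by positivity), ← h, ENNReal.ofReal_tsum_of_nonneg (fun κ => by positivity) hs]
  simp [ENNReal.ofReal_pow]

/-- Parseval's identity on a space-time layer. -/
lemma hasSum_integral_coef_sq {F : ℝ × Cyl n → ℝ} (hF : BddMeas F) (s t : ℝ) :
    HasSum (fun κ : ℤ × (Fin n → ℤ) => ∫ r in Ioc s t, ‖coef κ (fun u => F (r, u))‖ ^ 2)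
      (2 * ∫ r in Ioc s t, ∫ u in Omega n, F (r, u) ^ 2) := by
  obtain ⟨C, hC⟩ := hF.bdd
  have hb : ∀ (κ : ℤ × (Fin n → ℤ)), Integrable (fun r => ‖coef κ (fun u => F (r, u))‖ ^ 2)
      (volume.restrict (Ioc s t)) := by
    intro κ
    refine Integrable.of_bound
      (C := (C * (volume : Measure (Cyl n)).real (Omega n)) ^ 2)
      ((measurable_coef hF.meas κ).norm.pow_const 2).aestronglyMeasurable
      (Eventually.of_forall fun r => ?_)
    rw [norm_pow, norm_norm]
    gcongr
    exact norm_coef_le (fun u => hC (r, u)) κ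
  have h1 : ∀ r, HasSum (fun κ : ℤ × (Fin n → ℤ) => ‖coef κ (fun u => F (r, u))‖ ^ 2)
      (2 * ∫ u in Omega n, F (r, u) ^ 2) := fun r => hasSum_coef_sq (hF.section_right r)
  have hmeas2 : Measurable (fun r => ∫ u in Omega n, F (r, u) ^ 2) :=
    (StronglyMeasurable.integral_prod_right (f := fun (r : ℝ) (u : Cyl n) =>
      F (r, u) ^ 2) (hF.meas.pow_const 2).stronglyMeasurable).measurable
  have hint : Integrable (fun r => 2 * ∫ u in Omega n, F (r, u) ^ 2)
      (volume.restrict (Ioc s t)) := by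
    refine Integrable.const_mul (Integrable.of_bound
      (C := C ^ 2 * (volume : Measure (Cyl n)).real (Omega n)) hmeas2.aestronglyMeasurable
      (Eventually.of_forall fun r => ?_)) 2
    refine (norm_integral_le_of_norm_le_const (C := C ^ 2)
      (Eventually.of_forall fun u => ?_)).trans ?_
    · rw [norm_pow]; gcongr; exact hC _
    · rw [measureReal_restrict_apply_univ]
  rw [← integral_const_mul]
  have e : ∀ r, 2 * ∫ u in Omega n, F (r, u) ^ 2 = ∑' κ : ℤ × (Fin n → ℤ),
    ‖coef κ (fun u => F (r, u))‖ ^ 2 := fun r => (h1 r).tsum_eq.symm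
  simp_rw [e]
  refine hasSum_integral_of_summable_integral_norm hb ?_
  simp only [norm_pow, norm_norm]
  refine summable_of_sum_le (c := ∫ r in Ioc s t, 2 * ∫ u in Omega n, F (r, u) ^ 2)
    (fun κ => integral_nonneg fun r => by positivity) fun S => ?_
  rw [← integral_finsetSum _ fun κ _ => hb κ]
  refine integral_mono (integrable_finsetSum _ fun κ _ => hb κ) hint fun r => ?_
  exact sum_le_hasSum S (fun κ _ => by positivity) (h1 r)

/-! ### The axial Green function -/

/-- The Green function of `κ² - ∂²` on `(-1, 1)` with Dirichlet boundary conditions. -/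
def green (κ : ℝ) (p : ℝ × ℝ) : ℝ :=
  Real.sinh (κ * (1 + min p.1 p.2)) * Real.sinh (κ * (1 - max p.1 p.2)) / (κ * Real.sinh (2 * κ))

lemma green_symm (κ x z : ℝ) : green κ (x, z) = green κ (z, x) := by
  simp only [green, min_comm x z, max_comm x z]

lemma continuous_green (κ : ℝ) : Continuous (green κ) := by
  unfold green
  exact Continuous.div_const (by fun_prop) _

lemma green_nonneg {κ : ℝ} (hκ : 0 < κ) {x z : ℝ} (hx : x ∈ Icc (-1 : ℝ) 1)
    (hz : z ∈ Icc (-1 : ℝ) 1) : 0 ≤ green κ (x, z) := by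
  have h1 : -1 ≤ min x z := le_min hx.1 hz.1
  have h2 : max x z ≤ 1 := max_le hx.2 hz.2
  exact div_nonneg (mul_nonneg (Real.sinh_nonneg_iff.2 (mul_nonneg hκ.le (by linarith)))
    (Real.sinh_nonneg_iff.2 (mul_nonneg hκ.le (by linarith))))
    (mul_nonneg hκ.le (Real.sinh_nonneg_iff.2 (by linarith)))

/-- The sine is a Dirichlet eigenfunction of κ² - ∂² with eigenvalue κ² + ξ². The verification is
direct: sinh · sin has an explicit antiderivative on either side of x, and the addition formula for
sinh(2κ) cancels the normalisation of the kernel. -/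
lemma green_mul_axMode {κ : ℝ} (hκ : 0 < κ) (k : ℤ) {x : ℝ} (hx : x ∈ Icc (-1 : ℝ) 1) :
    ∫ z in Ioo (-1 : ℝ) 1, green κ (x, z) * axMode k z =
      (κ ^ 2 + (Real.pi * k / 2) ^ 2)⁻¹ * axMode k x := by
  set ξ : ℝ := Real.pi * k / 2 with hξ
  have hpos : 0 < κ ^ 2 + ξ ^ 2 := by positivity
  have hsh : 0 < Real.sinh (2 * κ) := Real.sinh_pos_iff.2 (by linarith)
  set s : ℝ → ℝ := fun z => Real.sin (ξ * (z + 1)) with hs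
  set c : ℝ → ℝ := fun z => Real.cos (ξ * (z + 1)) with hc
  have hax : ∀ z, axMode k z = s z := fun z => by
    simp only [axMode, hs, hξ]; congr 1; ring
  have ds : ∀ z, HasDerivAt s (c z * ξ) z := fun z => by
    simpa using (((hasDerivAt_id z).add_const 1).const_mul ξ).sin
  have dc : ∀ z, HasDerivAt c (-s z * ξ) z := fun z => by
    simpa using (((hasDerivAt_id z).add_const 1).const_mul ξ).cos
  have d1 : ∀ z, HasDerivAt (fun z => (κ * (Real.cosh (κ * (1 + z)) * s z) -
      ξ * (Real.sinh (κ * (1 + z)) * c z)) / (κ ^ 2 + ξ ^ 2))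
      (Real.sinh (κ * (1 + z)) * s z) z := fun z => by
    have a1 : HasDerivAt (fun z => κ * (1 + z)) κ z := by
      simpa using ((hasDerivAt_id z).const_add 1).const_mul κ
    have := (((a1.cosh.mul (ds z)).const_mul κ).sub ((a1.sinh.mul (dc z)).const_mul ξ)).div_const
      (κ ^ 2 + ξ ^ 2)
    refine this.congr_deriv ?_
    rw [div_eq_iff hpos.ne']
    ring
  have d2 : ∀ z, HasDerivAt (fun z => (-κ * (Real.cosh (κ * (1 - z)) * s z) -
      ξ * (Real.sinh (κ * (1 - z)) * c z)) / (κ ^ 2 + ξ ^ 2))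
      (Real.sinh (κ * (1 - z)) * s z) z := fun z => by
    have a1 : HasDerivAt (fun z => κ * (1 - z)) (-κ) z := by
      simpa using ((hasDerivAt_id z).const_sub 1).const_mul κ
    have := (((a1.cosh.mul (ds z)).const_mul (-κ)).sub ((a1.sinh.mul (dc z)).const_mul ξ)).div_const
      (κ ^ 2 + ξ ^ 2)
    refine this.congr_deriv ?_
    rw [div_eq_iff hpos.ne']
    ring
  have cs : Continuous s := by fun_prop
  have i1 : ∫ z in (-1 : ℝ)..x, Real.sinh (κ * (1 + z)) * s z = _ :=
    intervalIntegral.integral_eq_sub_of_hasDerivAt (fun z _ => d1 z)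
      (Continuous.intervalIntegrable (by fun_prop) _ _)
  have i2 : ∫ z in x..(1 : ℝ), Real.sinh (κ * (1 - z)) * s z = _ :=
    intervalIntegral.integral_eq_sub_of_hasDerivAt (fun z _ => d2 z)
      (Continuous.intervalIntegrable (by fun_prop) _ _)
  have s1 : s 1 = 0 := by
    simp only [hs, hξ]
    rw [show Real.pi * k / 2 * (1 + 1) = k * Real.pi by ring]; exact Real.sin_int_mul_pi k
  have s2 : s (-1) = 0 := by simp [hs]
  have cg : Continuous fun z => green κ (x, z) * s z :=
    ((continuous_green κ).comp (by fun_prop)).mul cs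
  simp_rw [hax]
  rw [← integral_Ioc_eq_integral_Ioo, ← intervalIntegral.integral_of_le (by norm_num),
    ← intervalIntegral.integral_add_adjacent_intervals (cg.intervalIntegrable (-1) x)
      (cg.intervalIntegrable x 1)]
  have e1 : ∫ z in (-1 : ℝ)..x, green κ (x, z) * s z = ∫ z in (-1 : ℝ)..x,
      (Real.sinh (κ * (1 - x)) / (κ * Real.sinh (2 * κ))) * (Real.sinh (κ * (1 + z)) * s z) := by
    refine intervalIntegral.integral_congr fun z hz => ?_
    rw [uIcc_of_le hx.1] at hz
    simp only [green, min_eq_right hz.2, max_eq_left hz.2]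
    ring
  have e2 : ∫ z in x..(1 : ℝ), green κ (x, z) * s z = ∫ z in x..(1 : ℝ),
      (Real.sinh (κ * (1 + x)) / (κ * Real.sinh (2 * κ))) * (Real.sinh (κ * (1 - z)) * s z) := by
    refine intervalIntegral.integral_congr fun z hz => ?_
    rw [uIcc_of_le hx.2] at hz
    simp only [green, min_eq_left hz.1, max_eq_right hz.1]
    ring
  rw [e1, e2, intervalIntegral.integral_const_mul, intervalIntegral.integral_const_mul, i1, i2,
    s1, s2]
  have hadd : Real.sinh (2 * κ) = Real.sinh (κ * (1 + x)) * Real.cosh (κ * (1 - x)) +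
      Real.cosh (κ * (1 + x)) * Real.sinh (κ * (1 - x)) := by
    rw [← Real.sinh_add]; congr 1; ring
  simp only [add_neg_cancel, sub_self, mul_zero, Real.sinh_zero, zero_mul, zero_div, sub_zero,
    zero_sub]
  field_simp
  rw [mul_comm κ 2, hadd]
  ring

/-- The Green function, cut off outside the open square. -/
def kern (κ : ℝ) : ℝ × ℝ → ℝ := (Ioo (-1 : ℝ) 1 ×ˢ Ioo (-1 : ℝ) 1).indicator (green κ)

lemma kern_apply {κ x z : ℝ} (hx : x ∈ Ioo (-1 : ℝ) 1) (hz : z ∈ Ioo (-1 : ℝ) 1) :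
    kern κ (x, z) = green κ (x, z) := indicator_of_mem (mk_mem_prod hx hz) _

/-- The cut-off matters here: outside the square `green` is unbounded and changes sign, whereas
boundedness and positivity are needed at every real point. -/
lemma bddMeas_kern (κ : ℝ) : BddMeas (kern κ) := by
  refine ⟨(continuous_green κ).measurable.indicator (measurableSet_Ioo.prod measurableSet_Ioo), ?_⟩
  obtain ⟨C, hC⟩ := ((isCompact_Icc (a := (-1 : ℝ)) (b := 1)).prod
    (isCompact_Icc (a := (-1 : ℝ)) (b := 1))).exists_bound_of_continuousOn
    (continuous_green κ).continuousOn
  refine ⟨C, fun p => ?_⟩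
  unfold kern
  by_cases hp : p ∈ Ioo (-1 : ℝ) 1 ×ˢ Ioo (-1 : ℝ) 1
  · rw [indicator_of_mem hp]
    exact hC p ⟨Ioo_subset_Icc_self hp.1, Ioo_subset_Icc_self hp.2⟩
  · rw [indicator_of_notMem hp, abs_zero]
    exact (norm_nonneg _).trans (hC (0, 0) (by constructor <;> simp))

lemma kern_nonneg {κ : ℝ} (hκ : 0 < κ) (p : ℝ × ℝ) : 0 ≤ kern κ p :=
  indicator_nonneg (fun _ hp => green_nonneg hκ (Ioo_subset_Icc_self hp.1)
    (Ioo_subset_Icc_self hp.2)) p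

/-! ### The bounded approximation of the Laplacian and its symbol -/

/-- The Dirichlet resolvent in the axial variable. -/
def axRes (κ : ℝ) (f : Cyl n → ℝ) (u : Cyl n) : ℝ :=
  ∫ z in Ioo (-1 : ℝ) 1, kern κ (u.1, z) * f (z, u.2)

/-- The sum of all translates of `f` by `±κ⁻¹` in the directions of the torus. -/
def torAvg (κ : ℝ) (f : Cyl n → ℝ) (u : Cyl n) : ℝ :=
  ∑ j : Fin n, (f (u + shift j.succ κ⁻¹) + f (u + shift j.succ (-κ⁻¹)))

/-- The positive part of the approximate Laplacian. -/
def posOp (κ : ℝ) (f : Cyl n → ℝ) (u : Cyl n) : ℝ :=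
  κ ^ 4 * axRes κ f u + κ ^ 2 * torAvg κ f u

/-- The diagonal part of the approximate Laplacian. -/
def diagC (n : ℕ) (κ : ℝ) : ℝ := κ ^ 2 + 2 * n * κ ^ 2

/-- A bounded approximation of the Dirichlet Laplacian. -/
def apxLap (κ : ℝ) (f : Cyl n → ℝ) (u : Cyl n) : ℝ := posOp κ f u - diagC n κ * f u

/-- The symbol of `-apxLap`. -/
def apxSymb (κ : ℝ) (i : ℤ × (Fin n → ℤ)) : ℝ :=
  κ ^ 2 * (Real.pi * i.1 / 2) ^ 2 / (κ ^ 2 + (Real.pi * i.1 / 2) ^ 2) +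
    ∑ j, 2 * κ ^ 2 * (1 - Real.cos (2 * Real.pi * i.2 j / κ))

lemma abs_axRes_le {κ K : ℝ} (hK : ∀ p, |kern κ p| ≤ K) {f : Cyl n → ℝ} {C : ℝ}
    (hC : ∀ u, |f u| ≤ C) (u : Cyl n) : |axRes κ f u| ≤ K * C * 2 := by
  rw [axRes, ← Real.norm_eq_abs]
  refine (norm_integral_le_of_norm_le_const (μ := volume.restrict (Ioo (-1 : ℝ) 1))
    (C := K * C) (Eventually.of_forall fun z => ?_)).trans ?_
  · rw [norm_mul]
    exact mul_le_mul (hK _) (hC _) (norm_nonneg _) ((abs_nonneg _).trans (hK (0, 0)))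
  · simp; norm_num

lemma abs_torAvg_le {κ : ℝ} {f : Cyl n → ℝ} {C : ℝ} (hC : ∀ u, |f u| ≤ C) (u : Cyl n) :
    |torAvg κ f u| ≤ n * (C + C) := by
  refine (Finset.abs_sum_le_sum_abs _ _).trans ?_
  refine (Finset.sum_le_card_nsmul _ _ (C + C) fun j _ =>
    (abs_add_le _ _).trans (add_le_add (hC _) (hC _))).trans ?_
  rw [Finset.card_univ, Fintype.card_fin, nsmul_eq_mul]

/-- The bound is in the sup norm over all points and depends on κ and n only; it supplies the
Lipschitz constant of the Picard iteration. -/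
lemma exists_abs_posOp_le (n : ℕ) (κ : ℝ) : ∃ D, 0 ≤ D ∧ ∀ (f : Cyl n → ℝ) (C : ℝ),
    (∀ u, |f u| ≤ C) → ∀ u, |posOp κ f u| ≤ D * C := by
  obtain ⟨K, hK⟩ := (bddMeas_kern κ).bdd
  have hK0 : 0 ≤ K := (abs_nonneg _).trans (hK (0, 0))
  refine ⟨κ ^ 4 * (K * 2) + κ ^ 2 * (n * 2), by positivity, fun f C hC u => ?_⟩
  refine (abs_add_le _ _).trans ?_
  rw [abs_mul, abs_mul, abs_of_nonneg (by positivity : 0 ≤ κ ^ 4), abs_of_nonneg (sq_nonneg κ)]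
  have h1 := mul_le_mul_of_nonneg_left (abs_axRes_le hK hC u) (by positivity : 0 ≤ κ ^ 4)
  have h2 := mul_le_mul_of_nonneg_left (abs_torAvg_le (κ := κ) hC u) (sq_nonneg κ)
  linarith

lemma measurable_shift_add (i : Fin (n + 1)) (h : ℝ) : Measurable fun u : Cyl n => u + shift i h :=
  (continuous_id.add continuous_const).measurable

lemma measurable_posOp (κ : ℝ) {F : ℝ × Cyl n → ℝ} (hF : Measurable F) :
    Measurable fun p : ℝ × Cyl n => posOp κ (fun u => F (p.1, u)) p.2 := by
  have h1 : Measurable fun p : ℝ × Cyl n => axRes κ (fun u => F (p.1, u)) p.2 := by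
    refine (StronglyMeasurable.integral_prod_right (f := fun (p : ℝ × Cyl n) (z : ℝ) =>
      kern κ (p.2.1, z) * F (p.1, (z, p.2.2))) ?_).measurable
    have := (bddMeas_kern κ).meas
    exact Measurable.stronglyMeasurable (by fun_prop)
  have h2 : Measurable fun p : ℝ × Cyl n => torAvg κ (fun u => F (p.1, u)) p.2 := by
    refine Finset.measurable_sum _ fun j _ => Measurable.add ?_ ?_
    · exact hF.comp (measurable_fst.prodMk ((measurable_shift_add _ _).comp measurable_snd))
    · exact hF.comp (measurable_fst.prodMk ((measurable_shift_add _ _).comp measurable_snd))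
  exact (h1.const_mul _).add (h2.const_mul _)

lemma bddMeas_posOp (κ : ℝ) {F : ℝ × Cyl n → ℝ} (hF : BddMeas F) :
    BddMeas fun p : ℝ × Cyl n => posOp κ (fun u => F (p.1, u)) p.2 := by
  refine ⟨measurable_posOp κ hF.meas, ?_⟩
  obtain ⟨D, -, hD⟩ := exists_abs_posOp_le n κ
  obtain ⟨C, hC⟩ := hF.bdd
  exact ⟨D * C, fun p => hD _ C (fun u => hC _) _⟩

/-- The maximum principle of the approximation: the Green kernel and the translations both preserve
sign. -/
lemma posOp_nonpos {κ : ℝ} (hκ : 0 < κ) {f : Cyl n → ℝ} (hf : ∀ u, f u ≤ 0) (u : Cyl n) :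
    posOp κ f u ≤ 0 := by
  have h1 : axRes κ f u ≤ 0 := integral_nonpos fun z =>
    mul_nonpos_of_nonneg_of_nonpos (kern_nonneg hκ _) (hf _)
  have h2 : torAvg κ f u ≤ 0 := Finset.sum_nonpos fun j _ => add_nonpos (hf _) (hf _)
  exact add_nonpos (mul_nonpos_of_nonneg_of_nonpos (by positivity) h1)
    (mul_nonpos_of_nonneg_of_nonpos (by positivity) h2)

lemma integrable_kern_mul (κ x : ℝ) {f : Cyl n → ℝ} (hf : BddMeas f) (y : UnitAddTorus (Fin n)) :
    Integrable (fun z => kern κ (x, z) * f (z, y)) (volume.restrict (Ioo (-1 : ℝ) 1)) :=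
  (((bddMeas_kern κ).section_right x).mul (hf.comp (measurable_id.prodMk measurable_const))).integrable _

lemma posOp_sub (κ : ℝ) {f g : Cyl n → ℝ} (hf : BddMeas f) (hg : BddMeas g) (u : Cyl n) :
    posOp κ (fun u => f u - g u) u = posOp κ f u - posOp κ g u := by
  have h1 : axRes κ (fun u => f u - g u) u = axRes κ f u - axRes κ g u := by
    rw [axRes, axRes, axRes, ← integral_sub (integrable_kern_mul κ _ hf _)
      (integrable_kern_mul κ _ hg _)]
    congr 1; ext z; ring
  have h2 : torAvg κ (fun u => f u - g u) u = torAvg κ f u - torAvg κ g u := by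
    rw [torAvg, torAvg, torAvg, ← Finset.sum_sub_distrib]
    exact Finset.sum_congr rfl fun j _ => by ring
  rw [posOp, posOp, posOp, h1, h2]; ring

lemma bddMeas_axRes (κ : ℝ) {f : Cyl n → ℝ} (hf : BddMeas f) : BddMeas (axRes κ f) := by
  obtain ⟨K, hK⟩ := (bddMeas_kern κ).bdd
  obtain ⟨C, hC⟩ := hf.bdd
  have hKm := (bddMeas_kern κ).meas
  have hfm := hf.meas
  exact ⟨(StronglyMeasurable.integral_prod_right (f := fun (u : Cyl n) (z : ℝ) =>
      kern κ (u.1, z) * f (z, u.2)) (Measurable.stronglyMeasurable (by fun_prop))).measurable,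
      K * C * 2, abs_axRes_le hK hC⟩

/-- Fubini moves the symmetric kernel onto the axial factor of the mode, which is an eigenfunction
of the resolvent. -/
lemma coef_axRes {κ : ℝ} (hκ : 0 < κ) {f : Cyl n → ℝ} (hf : BddMeas f) (i : ℤ × (Fin n → ℤ)) :
    coef i (axRes κ f) = ((κ ^ 2 + (Real.pi * i.1 / 2) ^ 2)⁻¹ : ℝ) * coef i f := by
  obtain ⟨K, hK⟩ := (bddMeas_kern κ).bdd
  obtain ⟨C, hC⟩ := hf.bdd
  have hKm := (bddMeas_kern κ).meas
  have hfm := hf.meas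
  have hK0 : 0 ≤ K := (abs_nonneg _).trans (hK (0, 0))
  have hres := bddMeas_axRes κ hf
  have hme : ∀ y, ‖UnitAddTorus.mFourier (-i.2) y‖ ≤ 1 := fun y =>
    (ContinuousMap.norm_coe_le_norm _ _).trans UnitAddTorus.mFourier_norm.le
  have hmm : Measurable (UnitAddTorus.mFourier (-i.2)) :=
    (UnitAddTorus.mFourier (-i.2)).continuous.measurable
  set Φ : ℝ → ℂ := fun x => ∫ y, (f (x, y) : ℂ) * UnitAddTorus.mFourier (-i.2) y with hΦ
  have hΦm : Measurable Φ := by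
    refine (StronglyMeasurable.integral_prod_right (f := fun (x : ℝ) (y : UnitAddTorus (Fin n)) =>
      (f (x, y) : ℂ) * UnitAddTorus.mFourier (-i.2) y) ?_).measurable
    exact Measurable.stronglyMeasurable (by fun_prop)
  have hΦb : ∀ x, ‖Φ x‖ ≤ C := by
    intro x
    refine (norm_integral_le_of_norm_le_const (C := C) (Eventually.of_forall fun y => ?_)).trans ?_
    · rw [norm_mul, Complex.norm_real, ← mul_one C]
      exact mul_le_mul (hC _) (hme y) (norm_nonneg _) ((abs_nonneg _).trans (hC (x, y)))
    · rw [probReal_univ, mul_one]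
  rw [coef_eq_iterated hres, coef_eq_iterated hf, ← integral_const_mul]
  have step : ∀ x, ∫ y, (axRes κ f (x, y) : ℂ) * UnitAddTorus.mFourier (-i.2) y =
      ∫ z in Ioo (-1 : ℝ) 1, (kern κ (x, z) : ℂ) * Φ z := by
    intro x
    simp only [axRes, hΦ]
    simp_rw [← integral_complex_ofReal, ← integral_mul_const, ← integral_const_mul]
    rw [integral_integral_swap]
    · congr 1; ext z; congr 1; ext y; push_cast; ring
    · refine Integrable.of_bound (C := K * C * 1) (Measurable.aestronglyMeasurable ?_)
        (Eventually.of_forall fun p => ?_)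
      · simp only [Function.uncurry_def]; fun_prop
      · simp only [Function.uncurry]
        rw [norm_mul, Complex.norm_real, norm_mul]
        exact mul_le_mul (mul_le_mul (hK _) (hC _) (norm_nonneg _) hK0) (hme _) (norm_nonneg _)
          (mul_nonneg hK0 ((abs_nonneg _).trans (hC (0, 0))))
  simp_rw [step]
  conv_lhs => simp only [← integral_mul_const]
  rw [integral_integral_swap]
  · refine setIntegral_congr_fun measurableSet_Ioo fun z hz => ?_
    have h1 : ∀ x ∈ Ioo (-1 : ℝ) 1, (kern κ (x, z) : ℂ) * Φ z * axMode i.1 x =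
        Φ z * ((green κ (z, x) * axMode i.1 x : ℝ) : ℂ) := fun x hx => by
      rw [kern_apply hx hz, green_symm]; push_cast; ring
    rw [setIntegral_congr_fun measurableSet_Ioo h1, integral_const_mul, integral_complex_ofReal,
      green_mul_axMode hκ _ (Ioo_subset_Icc_self hz)]
    push_cast; ring
  · have := (continuous_axMode i.1).measurable
    refine Integrable.of_bound (C := K * C * 1) (Measurable.aestronglyMeasurable ?_)
      (Eventually.of_forall fun p => ?_)
    · simp only [Function.uncurry_def]; fun_prop
    · simp only [Function.uncurry]
      rw [norm_mul, norm_mul, Complex.norm_real, Complex.norm_real]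
      exact mul_le_mul (mul_le_mul (hK _) (hΦb _) (norm_nonneg _) hK0) (abs_axMode_le _ _)
        (norm_nonneg _) (mul_nonneg hK0 ((abs_nonneg _).trans (hC (0, 0))))

lemma mFourier_add_arg (m : Fin n → ℤ) (x y : UnitAddTorus (Fin n)) :
    UnitAddTorus.mFourier m (x + y) = UnitAddTorus.mFourier m x * UnitAddTorus.mFourier m y := by
  simp only [UnitAddTorus.mFourier, ContinuousMap.coe_mk, ← Finset.prod_mul_distrib]
  refine Finset.prod_congr rfl fun j _ => ?_
  rw [Pi.add_apply, fourier_apply, fourier_apply, fourier_apply, smul_add, AddCircle.toCircle_add,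
    Circle.coe_mul]

lemma mFourier_single_arg (m : Fin n → ℤ) (j : Fin n) (h : ℝ) :
    UnitAddTorus.mFourier m (Pi.single j (h : UnitAddCircle)) =
      Complex.exp (2 * Real.pi * m j * h * Complex.I) := by
  simp only [UnitAddTorus.mFourier, ContinuousMap.coe_mk]
  rw [Finset.prod_eq_single j]
  · rw [Pi.single_eq_same, fourier_coe_apply]
    congr 1; push_cast; ring
  · intro b _ hb
    rw [Pi.single_eq_of_ne hb, fourier_eval_zero]
  · simp

/-- Translation invariance of Haar measure and multiplicativity of characters. The mode has
frequency -m, so the phase comes out with +m. -/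
lemma coef_shift (j : Fin n) (h : ℝ) {f : Cyl n → ℝ} (hf : BddMeas f) (i : ℤ × (Fin n → ℤ)) :
    coef i (fun u => f (u + shift j.succ h)) =
      Complex.exp (2 * Real.pi * i.2 j * h * Complex.I) * coef i f := by
  rw [coef_eq_iterated (hf.comp (measurable_shift_add _ _)), coef_eq_iterated hf,
    ← integral_const_mul]
  congr 1; ext x
  have hs : ∀ y, ((x, y) : Cyl n) + shift j.succ h = (x, y + Pi.single j (h : UnitAddCircle)) := by
    intro y; simp [shift]
  simp_rw [hs]
  have h1 : ∀ y : UnitAddTorus (Fin n), (f (x, y + Pi.single j (h : UnitAddCircle)) : ℂ) *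
      UnitAddTorus.mFourier (-i.2) y = (fun y' => Complex.exp (2 * Real.pi * i.2 j * h * Complex.I) *
        ((f (x, y') : ℂ) * UnitAddTorus.mFourier (-i.2) y')) (y + Pi.single j (h : UnitAddCircle)) := by
    intro y
    simp only [mFourier_add_arg, mFourier_single_arg]
    have : Complex.exp (2 * Real.pi * i.2 j * h * Complex.I) *
        Complex.exp (2 * Real.pi * ((-i.2) j : ℤ) * h * Complex.I) = 1 := by
      rw [← Complex.exp_add, ← Complex.exp_zero]; congr 1; simp
    linear_combination (-(f (x, y + Pi.single j (h : UnitAddCircle)) : ℂ) *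
      UnitAddTorus.mFourier (-i.2) y) * this
  rw [integral_congr_ae (Eventually.of_forall h1), integral_add_right_eq_self (μ := volume)
    (fun y' : UnitAddTorus (Fin n) => Complex.exp (2 * Real.pi * i.2 j * h * Complex.I) *
      ((f (x, y') : ℂ) * UnitAddTorus.mFourier (-i.2) y')), integral_const_mul]
  ring

lemma coef_sum {ι : Type*} (S : Finset ι) {F : ι → Cyl n → ℝ} (hF : ∀ j ∈ S, BddMeas (F j))
    (i : ℤ × (Fin n → ℤ)) : coef i (fun u => ∑ j ∈ S, F j u) = ∑ j ∈ S, coef i (F j) := by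
  simp only [coef]
  rw [← integral_finsetSum _ fun j hj => integrable_coef (hF j hj) i]
  congr 1; ext u; push_cast; rw [Finset.sum_mul]

lemma coef_torAvg (κ : ℝ) {f : Cyl n → ℝ} (hf : BddMeas f) (i : ℤ × (Fin n → ℤ)) :
    coef i (torAvg κ f) = (∑ j, 2 * Real.cos (2 * Real.pi * i.2 j / κ) : ℝ) * coef i f := by
  have h := fun (j : Fin n) (h : ℝ) => hf.comp (measurable_shift_add j.succ h)
  unfold torAvg
  rw [coef_sum _ (fun j _ => (h j _).add (h j _))]
  push_cast
  rw [Finset.sum_mul]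
  refine Finset.sum_congr rfl fun j _ => ?_
  rw [coef_add (h j _) (h j _), coef_shift _ _ hf, coef_shift _ _ hf, Complex.cos, ← add_mul]
  congr 1
  rw [mul_div_cancel₀ _ (two_ne_zero), div_eq_mul_inv]
  congr 1 <;> congr 1 <;> push_cast <;> ring

lemma bddMeas_torAvg (κ : ℝ) {f : Cyl n → ℝ} (hf : BddMeas f) : BddMeas (torAvg κ f) :=
  BddMeas.sum _ fun _ _ => (hf.comp (measurable_shift_add _ _)).add
    (hf.comp (measurable_shift_add _ _))

/-- `apxLap` acts on the modes as multiplication by `-apxSymb`. -/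
lemma coef_apxLap {κ : ℝ} (hκ : 0 < κ) {f : Cyl n → ℝ} (hf : BddMeas f) (i : ℤ × (Fin n → ℤ)) :
    coef i (apxLap κ f) = -(apxSymb κ i : ℂ) * coef i f := by
  have h1 := (bddMeas_axRes κ hf).const_mul (κ ^ 4)
  have h2 := (bddMeas_torAvg κ hf).const_mul (κ ^ 2)
  unfold apxLap posOp
  rw [coef_sub (h1.add h2) (hf.const_mul _), coef_add h1 h2, coef_const_mul, coef_const_mul,
    coef_const_mul, coef_axRes hκ hf, coef_torAvg κ hf]
  -- The axial part is the identity κ² - κ⁴/(κ² + ξ²) = κ²ξ²/(κ² + ξ²).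
  have : apxSymb κ i = diagC n κ - κ ^ 4 * (κ ^ 2 + (Real.pi * i.1 / 2) ^ 2)⁻¹ -
      κ ^ 2 * ∑ j, 2 * Real.cos (2 * Real.pi * i.2 j / κ) := by
    have hpos : 0 < κ ^ 2 + (Real.pi * i.1 / 2) ^ 2 := by positivity
    have hsum : ∑ j, 2 * κ ^ 2 * (1 - Real.cos (2 * Real.pi * i.2 j / κ)) =
        2 * n * κ ^ 2 - κ ^ 2 * ∑ j, 2 * Real.cos (2 * Real.pi * i.2 j / κ) := by
      simp only [mul_sub, mul_one, Finset.sum_sub_distrib, Finset.sum_const, Finset.card_univ,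
        Fintype.card_fin, nsmul_eq_mul, Finset.mul_sum]
      congr 1
      · ring
      · exact Finset.sum_congr rfl fun j _ => by ring
    rw [apxSymb, hsum, diagC]
    field_simp
    ring
  rw [this]
  push_cast
  ring

/-- The eigenvalue of `-Δ` for a mode. -/
def eigVal (i : ℤ × (Fin n → ℤ)) : ℝ :=
  (Real.pi * i.1 / 2) ^ 2 + ∑ j, (2 * Real.pi * i.2 j) ^ 2

lemma eigVal_pos {i : ℤ × (Fin n → ℤ)} (hi : i.1 ≠ 0) : 0 < eigVal i := by
  have : (0 : ℝ) < (Real.pi * i.1 / 2) ^ 2 := by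
    have : (i.1 : ℝ) ≠ 0 := by exact_mod_cast hi
    have := Real.pi_pos
    positivity
  exact add_pos_of_pos_of_nonneg this (Finset.sum_nonneg fun j _ => sq_nonneg _)

/-- Axially κ²ξ²/(κ² + ξ²) ≤ ξ²; on the torus 1 - cos θ ≤ θ²/2. -/
lemma apxSymb_le {κ : ℝ} (hκ : 0 < κ) (i : ℤ × (Fin n → ℤ)) : apxSymb κ i ≤ eigVal i := by
  refine add_le_add ?_ (Finset.sum_le_sum fun j _ => ?_)
  · rw [div_le_iff₀ (by positivity)]
    nlinarith [sq_nonneg ((Real.pi * i.1 / 2) ^ 2)]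
  · have := Real.one_sub_sq_div_two_le_cos (x := 2 * Real.pi * i.2 j / κ)
    have h2 : 2 * κ ^ 2 * ((2 * Real.pi * i.2 j / κ) ^ 2 / 2) = (2 * Real.pi * i.2 j) ^ 2 := by
      field_simp
    rw [← h2]
    gcongr
    linarith

/-- Here ξ² ≥ π²/4 ≥ 1 and κ² ≥ 1, and xy/(x + y) ≥ 1/2 whenever x, y ≥ 1. This spectral gap,
uniform in κ, allows the energy identity to be divided by the symbol. -/
lemma one_half_le_apxSymb {κ : ℝ} (hκ : 1 ≤ κ) {i : ℤ × (Fin n → ℤ)} (hi : i.1 ≠ 0) :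
    1 / 2 ≤ apxSymb κ i := by
  have h1 : (1 : ℝ) ≤ (Real.pi * i.1 / 2) ^ 2 := by
    have h2 : (1 : ℝ) ≤ (i.1 : ℝ) ^ 2 := by
      have : (1 : ℤ) ≤ i.1 ^ 2 := by
        have := sq_pos_of_ne_zero hi
        omega
      exact_mod_cast this
    have h3 := Real.pi_gt_three
    rw [show (Real.pi * i.1 / 2) ^ 2 = Real.pi ^ 2 / 4 * (i.1 : ℝ) ^ 2 by ring]
    exact one_le_mul_of_one_le_of_one_le (by nlinarith) h2
  have h4 : 0 ≤ ∑ j, 2 * κ ^ 2 * (1 - Real.cos (2 * Real.pi * i.2 j / κ)) :=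
    Finset.sum_nonneg fun j _ => mul_nonneg (by positivity)
      (sub_nonneg.2 (Real.cos_le_one _))
  have h5 : 1 / 2 ≤ κ ^ 2 * (Real.pi * i.1 / 2) ^ 2 / (κ ^ 2 + (Real.pi * i.1 / 2) ^ 2) := by
    rw [le_div_iff₀ (by positivity)]
    have : 1 ≤ κ ^ 2 := one_le_pow₀ hκ
    nlinarith
  exact le_add_of_le_of_nonneg h5 h4

/-- On the torus the half-angle formula rewrites 2κ²(1 - cos(θ/κ)) as (θ sinc(θ/(2κ)))², whose limit
follows from the continuity of sinc. -/
lemma tendsto_apxSymb (i : ℤ × (Fin n → ℤ)) :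
    Tendsto (fun N : ℕ => apxSymb ((N : ℝ) + 1) i) atTop (𝓝 (eigVal i)) := by
  have hN : Tendsto (fun N : ℕ => ((N : ℝ) + 1)⁻¹) atTop (𝓝[≠] 0) := by
    refine tendsto_nhdsWithin_iff.2 ⟨?_, Eventually.of_forall fun N => ?_⟩
    · exact tendsto_inv_atTop_zero.comp
        (tendsto_atTop_add_const_right _ _ tendsto_natCast_atTop_atTop)
    · simp only [mem_compl_iff, mem_singleton_iff]; positivity
  have hN0 := tendsto_nhds_of_tendsto_nhdsWithin hN
  refine Tendsto.add ?_ (tendsto_finsetSum _ fun j _ => ?_)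
  · have h1 : Tendsto (fun N : ℕ => (Real.pi * i.1 / 2) ^ 2 /
        (1 + (Real.pi * i.1 / 2) ^ 2 * ((N : ℝ) + 1)⁻¹ ^ 2)) atTop
        (𝓝 ((Real.pi * i.1 / 2) ^ 2 / (1 + (Real.pi * i.1 / 2) ^ 2 * 0 ^ 2))) :=
      Tendsto.div tendsto_const_nhds (((hN0.pow 2).const_mul _).const_add _) (by simp)
    refine (by simpa using h1 : Tendsto _ _ (𝓝 ((Real.pi * i.1 / 2) ^ 2))).congr fun N => ?_
    have : (0 : ℝ) < N + 1 := by positivity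
    field_simp
  · set θ : ℝ := 2 * Real.pi * i.2 j with hθ
    have h1 : ∀ N : ℕ, 2 * ((N : ℝ) + 1) ^ 2 * (1 - Real.cos (θ / (N + 1))) =
        (θ * Real.sinc (θ / 2 * ((N : ℝ) + 1)⁻¹)) ^ 2 := by
      intro N
      have hp : ((N : ℝ) + 1) ≠ 0 := by positivity
      have h2 : Real.cos (θ / (N + 1)) = 1 - 2 * Real.sin (θ / 2 * ((N : ℝ) + 1)⁻¹) ^ 2 := by
        rw [show θ / (N + 1) = 2 * (θ / 2 * ((N : ℝ) + 1)⁻¹) by field_simp, Real.cos_two_mul]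
        have := Real.sin_sq_add_cos_sq (θ / 2 * ((N : ℝ) + 1)⁻¹)
        linarith
      rw [h2]
      by_cases h0 : θ = 0
      · simp [h0]
      · rw [Real.sinc_of_ne_zero (by positivity)]
        field_simp
        ring
    simp_rw [h1]
    have h3 : Tendsto (fun N : ℕ => (θ * Real.sinc (θ / 2 * ((N : ℝ) + 1)⁻¹)) ^ 2) atTop
        (𝓝 ((θ * Real.sinc (θ / 2 * 0)) ^ 2)) :=
      ((((Real.continuous_sinc.tendsto _).comp (hN0.const_mul (θ / 2)))).const_mul θ).pow 2
    simpa using h3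

/-! ### Calculus of indefinite integrals -/

/-- The product rule for indefinite integrals. -/
lemma integral_product_rule {f f' g g' : ℝ → ℝ} {s t : ℝ} (hst : s ≤ t)
    (hf' : IntervalIntegrable f' volume s t) (hg' : IntervalIntegrable g' volume s t)
    (hf : ∀ r ∈ Icc s t, f r = f s + ∫ q in s..r, f' q)
    (hg : ∀ r ∈ Icc s t, g r = g s + ∫ q in s..r, g' q) :
    f t * g t - f s * g s = ∫ q in s..t, (f' q * g q + f q * g' q) := by
  have hs : s ∈ uIcc s t := left_mem_uIcc
  have hc : ∀ c : ℝ, AbsolutelyContinuousOnInterval (fun _ : ℝ => c) s t := fun c =>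
    ((LipschitzWith.const c).lipschitzOnWith).absolutelyContinuousOnInterval
  -- Indefinite integrals are absolutely continuous, so integration by parts applies although the
  -- derivatives exist only almost everywhere.
  have hF := (hc (f s)).fun_add (hf'.absolutelyContinuousOnInterval_intervalIntegral hs)
  have hG := (hc (g s)).fun_add (hg'.absolutelyContinuousOnInterval_intervalIntegral hs)
  have key := hF.integral_deriv_mul_eq_sub hG
  rw [← hf t (right_mem_Icc.2 hst), ← hg t (right_mem_Icc.2 hst), intervalIntegral.integral_same,
    intervalIntegral.integral_same, add_zero, add_zero] at key
  rw [← key]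
  refine intervalIntegral.integral_congr_ae ?_
  filter_upwards [hf'.ae_hasDerivAt_integral, hg'.ae_hasDerivAt_integral] with x h1 h2 hx
  have hx' : x ∈ uIcc s t := uIoc_subset_uIcc hx
  have hx2 : x ∈ Icc s t := by rwa [uIcc_of_le hst] at hx'
  rw [((h1 hx' s hs).const_add (f s)).deriv, ((h2 hx' s hs).const_add (g s)).deriv, ← hf x hx2,
    ← hg x hx2]

/-- The energy identity for complex valued indefinite integrals. -/
lemma integral_energy {f f' : ℝ → ℂ} {s t : ℝ} (hst : s ≤ t)
    (hf' : IntervalIntegrable f' volume s t)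
    (hf : ∀ r ∈ Icc s t, f r = f s + ∫ q in s..r, f' q) :
    ‖f t‖ ^ 2 - ‖f s‖ ^ 2 = ∫ q in s..t, 2 * ((f q).re * (f' q).re + (f q).im * (f' q).im) := by
  have hre' : IntervalIntegrable (fun q => (f' q).re) volume s t := ⟨hf'.1.re, hf'.2.re⟩
  have him' : IntervalIntegrable (fun q => (f' q).im) volume s t := ⟨hf'.1.im, hf'.2.im⟩
  have hsub : ∀ r ∈ Icc s t, IntervalIntegrable f' volume s r := fun r hr =>
    hf'.mono_set (by rw [uIcc_of_le hr.1, uIcc_of_le hst]; exact Icc_subset_Icc_right hr.2)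
  have hre : ∀ r ∈ Icc s t, (f r).re = (f s).re + ∫ q in s..r, (f' q).re := fun r hr => by
    rw [hf r hr, Complex.add_re, intervalIntegral.integral_of_le hr.1,
      intervalIntegral.integral_of_le hr.1]
    congr 1
    exact (integral_re (𝕜 := ℂ) (hsub r hr).1).symm
  have him : ∀ r ∈ Icc s t, (f r).im = (f s).im + ∫ q in s..r, (f' q).im := fun r hr => by
    rw [hf r hr, Complex.add_im, intervalIntegral.integral_of_le hr.1,
      intervalIntegral.integral_of_le hr.1]
    congr 1
    exact (integral_im (𝕜 := ℂ) (hsub r hr).1).symm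
  have cre : ContinuousOn (fun q => (f q).re) (uIcc s t) := by
    refine ContinuousOn.congr (f := fun r => (f s).re + ∫ q in s..r, (f' q).re) ?_ ?_
    · exact continuousOn_const.add
        (intervalIntegral.continuousOn_primitive_interval' hre' left_mem_uIcc)
    · intro r hr; rw [uIcc_of_le hst] at hr; exact hre r hr
  have cim : ContinuousOn (fun q => (f q).im) (uIcc s t) := by
    refine ContinuousOn.congr (f := fun r => (f s).im + ∫ q in s..r, (f' q).im) ?_ ?_
    · exact continuousOn_const.add
        (intervalIntegral.continuousOn_primitive_interval' him' left_mem_uIcc)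
    · intro r hr; rw [uIcc_of_le hst] at hr; exact him r hr
  have e1 := integral_product_rule hst hre' hre' hre hre
  have e2 := integral_product_rule hst him' him' him him
  have n1 : ∀ z : ℂ, ‖z‖ ^ 2 = z.re * z.re + z.im * z.im := fun z => by
    rw [Complex.sq_norm, Complex.normSq_apply]
  rw [n1, n1]
  calc (f t).re * (f t).re + (f t).im * (f t).im - ((f s).re * (f s).re + (f s).im * (f s).im)
      = ((f t).re * (f t).re - (f s).re * (f s).re) +
        ((f t).im * (f t).im - (f s).im * (f s).im) := by ring
    _ = _ := by
      rw [e1, e2, ← intervalIntegral.integral_add]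
      · refine intervalIntegral.integral_congr fun q _ => ?_
        ring
      · exact (hre'.mul_continuousOn cre).add (hre'.continuousOn_mul cre)
      · exact (him'.mul_continuousOn cim).add (him'.continuousOn_mul cim)

/-! ### Sign-preserving evolution equations -/

/-- Picard iteration for a linear evolution equation with bounded coefficients; the solution
inherits the sign of the initial datum. -/
lemma exists_nonpos_evolution {X : Type*} [MeasurableSpace X] (B : (ℝ × X → ℝ) → ℝ × X → ℝ)
    {D : ℝ} (hD : 0 < D) (hB : ∀ F, BddMeas F → BddMeas (B F))
    (hlip : ∀ F G, BddMeas F → BddMeas G → ∀ r E, (∀ x, |F (r, x) - G (r, x)| ≤ E) →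
      ∀ x, |B F (r, x) - B G (r, x)| ≤ D * E)
    (hneg : ∀ F, BddMeas F → (∀ p, F p ≤ 0) → ∀ p, B F p ≤ 0)
    {p₀ : X → ℝ} (hp₀ : BddMeas p₀) (hp₀neg : ∀ x, p₀ x ≤ 0) {s t : ℝ} (hst : s ≤ t) :
    ∃ P : ℝ × X → ℝ, BddMeas P ∧ (∀ p, P p ≤ 0) ∧
      ∀ r ∈ Icc s t, ∀ x, P (r, x) = p₀ x + ∫ q in s..r, B P (q, x) := by
  -- The Volterra map. An indicator replaces the variable upper limit, so that Φ F is defined and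
  -- bounded at all real times, not only on [s, t].
  set Φ : (ℝ × X → ℝ) → ℝ × X → ℝ := fun F p =>
    p₀ p.2 + ∫ q in Ioc s t, (Iic p.1).indicator (fun q => B F (q, p.2)) q with hΦ
  have hset : MeasurableSet {p : (ℝ × X) × ℝ | p.2 ≤ p.1.1} :=
    measurableSet_le measurable_snd (measurable_fst.comp measurable_fst)
  have hInt : ∀ F, BddMeas F → ∀ r x,
      Integrable ((Iic r).indicator fun q => B F (q, x)) (volume.restrict (Ioc s t)) :=
    fun F hF r x => (((hB F hF).comp
      (measurable_id.prodMk measurable_const : Measurable fun q : ℝ => (q, x))).integrable _).indicator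
        measurableSet_Iic
  have hΦb : ∀ F, BddMeas F → BddMeas (Φ F) := by
    intro F hF
    refine (hp₀.comp measurable_snd).add ⟨?_, ?_⟩
    · refine (StronglyMeasurable.integral_prod_right (f := fun (p : ℝ × X) (q : ℝ) =>
        (Iic p.1).indicator (fun q => B F (q, p.2)) q) ?_).measurable
      have : (Function.uncurry fun (p : ℝ × X) (q : ℝ) =>
          (Iic p.1).indicator (fun q => B F (q, p.2)) q) =
          {p : (ℝ × X) × ℝ | p.2 ≤ p.1.1}.indicator (fun p => B F (p.2, p.1.2)) := by
        ext ⟨p, q⟩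
        simp [Function.uncurry, indicator]
      rw [this]
      exact (((hB F hF).meas.comp (measurable_snd.prodMk
        (measurable_snd.comp measurable_fst))).indicator hset).stronglyMeasurable
    · obtain ⟨C, hC⟩ := (hB F hF).bdd
      refine ⟨C * volume.real (Ioc s t), fun p => ?_⟩
      rw [← Real.norm_eq_abs]
      refine norm_setIntegral_le_of_norm_le_const measure_Ioc_lt_top fun q _ => ?_
      exact (norm_indicator_le_norm_self _ _).trans (hC _)
  -- In the norm weighted by an exponential of rate 2D, Φ contracts by the factor 1/2 however long
  -- the interval is. The cap at t keeps the weight bounded.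
  set w : ℝ → ℝ := fun r => Real.exp (2 * D * (min r t - s)) with hw
  have hcontr : ∀ F G, BddMeas F → BddMeas G → ∀ E, 0 ≤ E →
      (∀ p, |F p - G p| ≤ E * w p.1) → ∀ p, |Φ F p - Φ G p| ≤ E / 2 * w p.1 := by
    intro F G hF hG E hE h p
    have e1 : Φ F p - Φ G p = ∫ q in Ioc s t,
        (Iic p.1).indicator (fun q => B F (q, p.2) - B G (q, p.2)) q := by
      simp only [hΦ, add_sub_add_left_eq_sub]
      rw [← integral_sub (hInt F hF _ _) (hInt G hG _ _)]
      congr 1; ext q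
      exact congrFun (indicator_sub (Iic p.1) (fun q => B F (q, p.2)) (fun q => B G (q, p.2))) q |>.symm
    set W : ℝ → ℝ := fun q => D * E * Real.exp (-(2 * D * s)) * Real.exp (2 * D * q) with hW
    have hWi : IntegrableOn W (Iic (min p.1 t)) :=
      (integrableOn_exp_mul_Iic (by positivity) _).const_mul _
    rw [e1, ← Real.norm_eq_abs]
    calc ‖∫ q in Ioc s t, (Iic p.1).indicator (fun q => B F (q, p.2) - B G (q, p.2)) q‖
        ≤ ∫ q in Ioc s t, (Iic (min p.1 t)).indicator W q := by
          refine norm_integral_le_of_norm_le ((hWi.integrable_indicator measurableSet_Iic).restrict)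
            ((ae_restrict_iff' measurableSet_Ioc).2 (Eventually.of_forall fun q hq => ?_))
          by_cases hqp : q ≤ p.1
          · rw [indicator_of_mem (show q ∈ Iic p.1 from hqp),
              indicator_of_mem (show q ∈ Iic (min p.1 t) from le_min hqp hq.2)]
            refine (hlip F G hF hG q (E * w q) (fun x => h (q, x)) p.2).trans_eq ?_
            simp only [hw, hW, min_eq_left hq.2]
            rw [show 2 * D * (q - s) = -(2 * D * s) + 2 * D * q by ring, Real.exp_add]
            ring
          · rw [indicator_of_notMem (show q ∉ Iic p.1 from hqp), norm_zero]
            exact indicator_nonneg (fun q _ => by positivity) q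
      _ ≤ ∫ q, (Iic (min p.1 t)).indicator W q :=
          setIntegral_le_integral (hWi.integrable_indicator measurableSet_Iic)
            (Eventually.of_forall (indicator_nonneg fun q _ => by positivity))
      _ = E / 2 * w p.1 := by
          rw [integral_indicator measurableSet_Iic, integral_const_mul,
            integral_exp_mul_Iic (by positivity)]
          simp only [hw]
          rw [show 2 * D * (min p.1 t - s) = -(2 * D * s) + 2 * D * min p.1 t by ring, Real.exp_add]
          field_simp
  set f : ℕ → ℝ × X → ℝ := fun m => Φ^[m] (fun p => p₀ p.2) with hf
  have hfs : ∀ m, f (m + 1) = Φ (f m) := fun m => Function.iterate_succ_apply' Φ m _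
  have hfb : ∀ m, BddMeas (f m) := by
    intro m
    induction m with
    | zero => exact hp₀.comp measurable_snd
    | succ m ih => rw [hfs]; exact hΦb _ ih
  have hfneg : ∀ m p, f m p ≤ 0 := by
    intro m
    induction m with
    | zero => exact fun p => hp₀neg p.2
    | succ m ih =>
      intro p
      rw [hfs]
      exact add_nonpos (hp₀neg _) (integral_nonpos fun q =>
        indicator_nonpos (fun q _ => hneg _ (hfb m) ih _) q)
  obtain ⟨K, hK0, hK⟩ : ∃ K, 0 ≤ K ∧ ∀ p, |f 1 p - f 0 p| ≤ K * w p.1 := by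
    obtain ⟨C, hC⟩ := (hB _ (hfb 0)).bdd
    refine ⟨|C| * volume.real (Ioc s t), by positivity, fun p => ?_⟩
    have e : f 1 p - f 0 p = ∫ q in Ioc s t, (Iic p.1).indicator (fun q => B (f 0) (q, p.2)) q := by
      rw [hfs 0]; simp only [hΦ, hf, Function.iterate_zero, id]; ring
    rw [e]
    by_cases hp : s ≤ p.1
    · have hw1 : 1 ≤ w p.1 := Real.one_le_exp
        (mul_nonneg (by positivity) (sub_nonneg.2 (le_min hp hst)))
      have hb := norm_setIntegral_le_of_norm_le_const (μ := volume) (C := |C|)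
        (measure_Ioc_lt_top (a := s) (b := t))
        (f := (Iic p.1).indicator (fun q => B (f 0) (q, p.2))) fun q _ =>
          (norm_indicator_le_norm_self _ _).trans ((hC _).trans (le_abs_self C))
      exact hb.trans (le_mul_of_one_le_right (by positivity) hw1)
    · rw [setIntegral_eq_zero_of_forall_eq_zero fun q hq =>
        indicator_of_notMem (show q ∉ Iic p.1 from fun h => hp (hq.1.le.trans h)) _, abs_zero]
      positivity
  have hgeo : ∀ m p, |f (m + 1) p - f m p| ≤ K / 2 ^ m * w p.1 := by
    intro m
    induction m with
    | zero => simpa using hK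
    | succ m ih =>
      intro p
      have h := hcontr _ _ (hfb (m + 1)) (hfb m) _ (by positivity) ih p
      rw [← hfs, ← hfs] at h
      refine h.trans_eq ?_
      rw [pow_succ]; ring
  have hdist : ∀ p m, dist (f m p) (f (m + 1) p) ≤ 2 * K * w p.1 / 2 / 2 ^ m := by
    intro p m
    rw [dist_comm, Real.dist_eq]
    refine (hgeo m p).trans_eq ?_
    ring
  have hlim : ∀ p, ∃ a, Tendsto (fun m => f m p) atTop (𝓝 a) := fun p =>
    cauchySeq_tendsto_of_complete (cauchySeq_of_le_geometric_two (hdist p))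
  choose P hP using hlim
  have hPd : ∀ m p, |f m p - P p| ≤ 2 * K / 2 ^ m * w p.1 := by
    intro m p
    have := dist_le_of_le_geometric_two_of_tendsto (hdist p) (hP p) m
    rw [Real.dist_eq] at this
    refine this.trans_eq ?_
    ring
  have hwb : ∀ r, w r ≤ Real.exp (2 * D * (t - s)) := fun r =>
    Real.exp_le_exp.2 (mul_le_mul_of_nonneg_left (by linarith [min_le_right r t]) (by positivity))
  have hPb : BddMeas P := by
    refine ⟨measurable_of_tendsto_metrizable (fun m => (hfb m).meas) (tendsto_pi_nhds.2 hP), ?_⟩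
    obtain ⟨C, hC⟩ := (hfb 0).bdd
    refine ⟨C + 2 * K * Real.exp (2 * D * (t - s)), fun p => ?_⟩
    have h1 := hPd 0 p
    have h2 : 2 * K / 2 ^ 0 * w p.1 ≤ 2 * K * Real.exp (2 * D * (t - s)) := by
      rw [pow_zero, div_one]; exact mul_le_mul_of_nonneg_left (hwb _) (by positivity)
    have h3 : |P p| ≤ |f 0 p| + |f 0 p - P p| := by
      have := abs_sub_abs_le_abs_sub (P p) (f 0 p)
      rw [abs_sub_comm (P p)] at this; linarith
    linarith [hC p]
  have hfix : ∀ p, Φ P p = P p := by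
    intro p
    have h1 : ∀ m : ℕ, |Φ P p - P p| ≤ 2 * K * w p.1 * (1 / 2) ^ m := by
      intro m
      have h2 := hcontr _ _ hPb (hfb m) (2 * K / 2 ^ m) (by positivity)
        (fun p => by rw [abs_sub_comm]; exact hPd m p) p
      rw [← hfs] at h2
      have h3 := hPd (m + 1) p
      have h4 := abs_sub_le (Φ P p) (f (m + 1) p) (P p)
      refine h4.trans ((add_le_add h2 h3).trans_eq ?_)
      rw [pow_succ, one_div, inv_pow]; field_simp; ring
    have h5 : Tendsto (fun m : ℕ => 2 * K * w p.1 * (1 / 2 : ℝ) ^ m) atTop (𝓝 0) := by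
      simpa using (tendsto_pow_atTop_nhds_zero_of_lt_one (r := (1 / 2 : ℝ)) (by norm_num)
        (by norm_num)).const_mul (2 * K * w p.1)
    have h6 := ge_of_tendsto' h5 h1
    exact sub_eq_zero.1 (abs_nonpos_iff.1 h6)
  refine ⟨P, hPb, fun p => le_of_tendsto' (hP p) fun m => hfneg m p, fun r hr x => ?_⟩
  rw [← hfix (r, x)]
  simp only [hΦ]
  rw [intervalIntegral.integral_of_le hr.1, setIntegral_indicator measurableSet_Iic,
    Ioc_inter_Iic, min_eq_right hr.2]

/-- The evolution equation driven by the bounded approximation of the Laplacian has a solution,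
and it preserves the sign. -/
lemma exists_nonpos_apxLap_evolution {κ : ℝ} (hκ : 0 < κ) {v : ℝ × Cyl n → ℝ} (hv : BddMeas v)
    (hv0 : ∀ p, 0 ≤ v p) {p₀ : Cyl n → ℝ} (hp₀ : BddMeas p₀) (hp₀neg : ∀ x, p₀ x ≤ 0) {s t : ℝ}
    (hst : s ≤ t) :
    ∃ p : ℝ × Cyl n → ℝ, BddMeas p ∧ (∀ z, p z ≤ 0) ∧
      ∀ r ∈ Icc s t, ∀ u, p (r, u) = p₀ u +
        ∫ q in s..r, apxLap κ (fun u' => v (q, u') * p (q, u')) u := by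
  obtain ⟨C, hC⟩ := hv.bdd
  have hC0 : 0 ≤ C := (abs_nonneg _).trans (hC 0)
  obtain ⟨K, hK0, hK⟩ := exists_abs_posOp_le n κ
  have hd0 : 0 ≤ diagC n κ := by unfold diagC; positivity
  -- The diagonal term of the generator has the wrong sign. Adding L makes L - `diagC` · v
  -- nonnegative, so that `B` preserves sign; the factor exp(-L(r - s)) removes L afterwards.
  set L : ℝ := diagC n κ * C with hL
  have hL0 : 0 ≤ L := mul_nonneg hd0 hC0
  have hLv : ∀ z, 0 ≤ L - diagC n κ * v z := fun z =>
    sub_nonneg.2 (mul_le_mul_of_nonneg_left ((le_abs_self _).trans (hC z)) hd0)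
  have hLv' : ∀ z, L - diagC n κ * v z ≤ L := fun z => by
    have := mul_nonneg hd0 (hv0 z); linarith
  set B : (ℝ × Cyl n → ℝ) → ℝ × Cyl n → ℝ := fun F z =>
    posOp κ (fun u => v (z.1, u) * F (z.1, u)) z.2 + (L - diagC n κ * v z) * F z with hB
  have hBb : ∀ F, BddMeas F → BddMeas (B F) := fun F hF =>
    (bddMeas_posOp κ (hv.mul hF)).add (((BddMeas.const L).sub (hv.const_mul _)).mul hF)
  -- The summand 1 in D only ensures strict positivity.
  obtain ⟨P, hPb, hPneg, hP⟩ := exists_nonpos_evolution B (D := K * C + L + 1) (by positivity) hBb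
    (by
      intro F G hF hG r E hE u
      have e : B F (r, u) - B G (r, u) =
          posOp κ (fun u => v (r, u) * (F (r, u) - G (r, u))) u +
          (L - diagC n κ * v (r, u)) * (F (r, u) - G (r, u)) := by
        simp only [hB, mul_sub]
        rw [posOp_sub κ ((hv.section_right r).mul (hF.section_right r))
          ((hv.section_right r).mul (hG.section_right r))]
        ring
      have hE0 : 0 ≤ E := (abs_nonneg _).trans (hE u)
      rw [e]
      refine (abs_add_le _ _).trans ?_
      have h1 := hK (fun u => v (r, u) * (F (r, u) - G (r, u))) (C * E) (fun u => by
        rw [abs_mul]; exact mul_le_mul (hC _) (hE u) (abs_nonneg _) hC0) u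
      have h2 : |(L - diagC n κ * v (r, u)) * (F (r, u) - G (r, u))| ≤ L * E := by
        rw [abs_mul, abs_of_nonneg (hLv _)]
        exact mul_le_mul (hLv' _) (hE u) (abs_nonneg _) hL0
      linarith)
    (fun F hF hneg z => add_nonpos
      (posOp_nonpos hκ (fun u => mul_nonpos_of_nonneg_of_nonpos (hv0 _) (hneg _)) _)
      (mul_nonpos_of_nonneg_of_nonpos (hLv z) (hneg z)))
    hp₀ hp₀neg hst
  -- With max r s the factor stays at most 1 at times before s as well.
  set e : ℝ → ℝ := fun r => Real.exp (-L * (max r s - s)) with he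
  have heb : BddMeas e := by
    refine ⟨by fun_prop, 1, fun r => ?_⟩
    rw [abs_of_pos (Real.exp_pos _), Real.exp_le_one_iff]
    have : 0 ≤ max r s - s := sub_nonneg.2 (le_max_right _ _)
    nlinarith
  have hes : e s = 1 := by simp [he]
  refine ⟨fun z => e z.1 * P z, (heb.comp measurable_fst).mul hPb, fun z =>
    mul_nonpos_of_nonneg_of_nonpos (Real.exp_pos _).le (hPneg z), fun r hr u => ?_⟩
  have hPs : P (s, u) = p₀ u := by rw [hP s (left_mem_Icc.2 hst)]; simp
  have hder : ∀ x ∈ Icc s r, e x = e s + ∫ q in s..x, -L * Real.exp (-L * (q - s)) := by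
    intro x hx
    have h1 : ∫ q in s..x, -L * Real.exp (-L * (q - s)) =
        Real.exp (-L * (x - s)) - Real.exp (-L * (s - s)) := by
      refine intervalIntegral.integral_eq_sub_of_hasDerivAt
        (f := fun q => Real.exp (-L * (q - s))) (fun q _ => ?_)
        (Continuous.intervalIntegrable (by fun_prop) _ _)
      have := (((hasDerivAt_id q).sub_const s).const_mul (-L)).exp
      simpa [mul_comm] using this
    rw [h1]; simp [he, max_eq_left hx.1]
  have hBi : ∀ u a b, IntervalIntegrable (fun q => B P (q, u)) volume a b := fun u a b => by
    rw [intervalIntegrable_iff, IntegrableOn, uIoc]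
    exact ((hBb P hPb).comp (measurable_id.prodMk measurable_const)).integrable _
  have key := integral_product_rule (f := e) (g := fun q => P (q, u)) hr.1
    (Continuous.intervalIntegrable (by fun_prop) _ _) (hBi u _ _) hder (fun x hx => by
      rw [hPs]; exact hP x ⟨hx.1, hx.2.trans hr.2⟩ u)
  simp only at key ⊢
  rw [hes, one_mul, hPs, sub_eq_iff_eq_add'] at key
  rw [key]
  congr 1
  refine intervalIntegral.integral_congr fun q hq => ?_
  rw [uIcc_of_le hr.1] at hq
  have heq : Real.exp (-L * (q - s)) = e q := by simp [he, max_eq_left hq.1]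
  have hpos : posOp κ (fun u' => v (q, u') * (e q * P (q, u'))) u =
      e q * posOp κ (fun u' => v (q, u') * P (q, u')) u := by
    simp only [posOp, axRes, torAvg]
    rw [show (fun z => kern κ (u.1, z) * (v (q, z, u.2) * (e q * P (q, z, u.2)))) =
      fun z => e q * (kern κ (u.1, z) * (v (q, z, u.2) * P (q, z, u.2))) by ext z; ring,
      integral_const_mul, mul_add, Finset.mul_sum, Finset.mul_sum, Finset.mul_sum]
    congr 1
    · ring
    · exact Finset.sum_congr rfl fun j _ => by ring
  simp only [apxLap, hpos, heq, hB]
  ring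

/-! ### Mode coefficients on a space-time layer -/

/-- Indices with k = 0 label the zero function. They are kept so that the axial index is all of ℤ,
and are set aside wherever a lower bound for the symbol or the eigenvalue is needed. -/
lemma coef_eq_zero {i : ℤ × (Fin n → ℤ)} (hi : i.1 = 0) (f : Cyl n → ℝ) : coef i f = 0 := by
  simp [coef, mode, axMode, hi]

lemma coef_congr_ae {f g : Cyl n → ℝ} (h : f =ᵐ[volume.restrict (Omega n)] g)
    (i : ℤ × (Fin n → ℤ)) : coef i f = coef i g :=
  integral_congr_ae (h.mono fun u hu => by simp only [hu])

lemma coef_integral {F : ℝ × Cyl n → ℝ} (hF : BddMeas F) {s r : ℝ} (hsr : s ≤ r)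
    (i : ℤ × (Fin n → ℤ)) :
    coef i (fun u => ∫ q in s..r, F (q, u)) = ∫ q in s..r, coef i (fun u => F (q, u)) := by
  obtain ⟨C, hC⟩ := hF.bdd
  simp only [coef, intervalIntegral.integral_of_le hsr]
  simp_rw [← integral_complex_ofReal, ← integral_mul_const]
  rw [integral_integral_swap]
  refine Integrable.of_bound (C := C * 1) (Measurable.aestronglyMeasurable ?_)
    (Eventually.of_forall fun p => ?_)
  · have := hF.meas
    have := (continuous_mode i).measurable
    simp only [Function.uncurry_def]
    fun_prop
  · simp only [Function.uncurry]
    rw [norm_mul, Complex.norm_real]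
    exact mul_le_mul (hC _) (norm_mode_le _ _) (norm_nonneg _) ((abs_nonneg _).trans (hC 0))

/-- The measure of the layer `(s, t] × Ω`. -/
def layerMeasure (n : ℕ) (s t : ℝ) : Measure (ℝ × Cyl n) :=
  (volume.restrict (Ioc s t)).prod (volume.restrict (Omega n))

instance (s t : ℝ) : IsFiniteMeasure (layerMeasure n s t) := by
  unfold layerMeasure; infer_instance

lemma hasSum_integral_coef_sq_layer {F : ℝ × Cyl n → ℝ} (hF : BddMeas F) {s t : ℝ} (hst : s ≤ t) :
    HasSum (fun i : ℤ × (Fin n → ℤ) => ∫ r in s..t, ‖coef i (fun u => F (r, u))‖ ^ 2)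
      (2 * ∫ p, F p ^ 2 ∂layerMeasure n s t) := by
  have h : Integrable (fun p => F p ^ 2) (layerMeasure n s t) := by
    simpa only [sq] using (hF.mul hF).integrable _
  have h2 := hasSum_integral_coef_sq hF s t
  rw [layerMeasure] at h ⊢
  rw [integral_prod _ h]
  simpa only [intervalIntegral.integral_of_le hst] using h2

lemma intervalIntegrable_coef {F : ℝ × Cyl n → ℝ} (hF : BddMeas F) (i : ℤ × (Fin n → ℤ)) (a b : ℝ) :
    IntervalIntegrable (fun r => coef i (fun u => F (r, u))) volume a b := by
  obtain ⟨C, hC⟩ := hF.bdd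
  exact (intervalIntegrable_const (c := C * (volume : Measure (Cyl n)).real (Omega n))).mono_fun
    (measurable_coef hF.meas i).aestronglyMeasurable
    (Eventually.of_forall fun r => (norm_coef_le (fun u => hC (r, u)) i).trans (le_abs_self _))

lemma intervalIntegrable_coef_mul {F G : ℝ × Cyl n → ℝ} (hF : BddMeas F) (hG : BddMeas G)
    (i : ℤ × (Fin n → ℤ)) (a b : ℝ) :
    IntervalIntegrable (fun r => (coef i (fun u => F (r, u))).re * (coef i (fun u => G (r, u))).re +
      (coef i (fun u => F (r, u))).im * (coef i (fun u => G (r, u))).im) volume a b := by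
  obtain ⟨C, hC⟩ := hF.bdd
  obtain ⟨D, hD⟩ := hG.bdd
  set V := (volume : Measure (Cyl n)).real (Omega n)
  have hFm := measurable_coef hF.meas i
  have hGm := measurable_coef hG.meas i
  have hb : ∀ {x y X Y : ℝ}, |x| ≤ X → |y| ≤ Y → |x * y| ≤ X * Y := fun hx hy => by
    rw [abs_mul]; exact mul_le_mul hx hy (abs_nonneg _) ((abs_nonneg _).trans hx)
  refine (intervalIntegrable_const (c := C * V * (D * V) + C * V * (D * V))).mono_fun
    (Measurable.aestronglyMeasurable ?_)
    (Eventually.of_forall fun r => le_trans ?_ (le_abs_self _))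
  · exact ((Complex.measurable_re.comp hFm).mul (Complex.measurable_re.comp hGm)).add
      ((Complex.measurable_im.comp hFm).mul (Complex.measurable_im.comp hGm))
  · have h1 := norm_coef_le (fun u => hC (r, u)) i
    have h2 := norm_coef_le (fun u => hD (r, u)) i
    exact (abs_add_le _ _).trans (add_le_add
      (hb ((Complex.abs_re_le_norm _).trans h1) ((Complex.abs_re_le_norm _).trans h2))
      (hb ((Complex.abs_im_le_norm _).trans h1) ((Complex.abs_im_le_norm _).trans h2)))

lemma intervalIntegrable_coef_sq {F : ℝ × Cyl n → ℝ} (hF : BddMeas F)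
    (i : ℤ × (Fin n → ℤ)) (a b : ℝ) :
    IntervalIntegrable (fun r => ‖coef i (fun u => F (r, u))‖ ^ 2) volume a b := by
  have h := intervalIntegrable_coef_mul hF hF i a b
  simpa only [Complex.sq_norm, Complex.normSq_apply] using h

/-- The polarised Parseval identity on a layer. -/
lemma hasSum_integral_coef_mul {F G : ℝ × Cyl n → ℝ} (hF : BddMeas F) (hG : BddMeas G) {s t : ℝ}
    (hst : s ≤ t) :
    HasSum (fun i : ℤ × (Fin n → ℤ) => ∫ r in s..t,
      ((coef i (fun u => F (r, u))).re * (coef i (fun u => G (r, u))).re +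
      (coef i (fun u => F (r, u))).im * (coef i (fun u => G (r, u))).im))
      (2 * ∫ p, F p * G p ∂layerMeasure n s t) := by
  -- Polarisation: half of ‖F + G‖² - ‖F‖² - ‖G‖².
  have h := (((hasSum_integral_coef_sq_layer (hF.add hG) hst).sub
    (hasSum_integral_coef_sq_layer hF hst)).sub (hasSum_integral_coef_sq_layer hG hst)).mul_left
    (1 / 2)
  have e1 : (1 / 2 : ℝ) * (2 * ∫ p, (F p + G p) ^ 2 ∂layerMeasure n s t -
      2 * ∫ p, F p ^ 2 ∂layerMeasure n s t - 2 * ∫ p, G p ^ 2 ∂layerMeasure n s t) =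
      2 * ∫ p, F p * G p ∂layerMeasure n s t := by
    have : ∀ p, (F p + G p) ^ 2 = F p * F p + G p * G p + 2 * (F p * G p) := fun p => by ring
    simp_rw [this, sq]
    rw [integral_add (((hF.mul hF).add (hG.mul hG)).integrable _)
      (((hF.mul hG).const_mul 2).integrable _), integral_add ((hF.mul hF).integrable _)
      ((hG.mul hG).integrable _), integral_const_mul]
    ring
  rw [e1] at h
  refine h.congr_fun fun i => ?_
  rw [← intervalIntegral.integral_sub (intervalIntegrable_coef_sq (hF.add hG) i _ _)
    (intervalIntegrable_coef_sq hF i _ _), ← intervalIntegral.integral_sub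
    ((intervalIntegrable_coef_sq (hF.add hG) i _ _).sub (intervalIntegrable_coef_sq hF i _ _))
    (intervalIntegrable_coef_sq hG i _ _), ← intervalIntegral.integral_const_mul]
  refine intervalIntegral.integral_congr fun r _ => ?_
  rw [coef_add (hF.section_right r) (hG.section_right r)]
  simp only [Complex.sq_norm, Complex.normSq_apply, Complex.add_re, Complex.add_im]
  ring

/-! ### The energy estimate and comparison in the layer -/

/-- The relative error of the symbol of the approximate Laplacian. -/
def symbErr (κ : ℝ) (i : ℤ × (Fin n → ℤ)) : ℝ := 1 - apxSymb κ i / eigVal i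

lemma symbErr_mem {κ : ℝ} (hκ : 1 ≤ κ) {i : ℤ × (Fin n → ℤ)} (hi : i.1 ≠ 0) :
    symbErr κ i ∈ Icc (0 : ℝ) 1 := by
  have h1 := one_half_le_apxSymb hκ hi
  have h2 := apxSymb_le (by linarith : 0 < κ) i
  have h3 := eigVal_pos hi
  have h4 : apxSymb κ i / eigVal i ≤ 1 := (div_le_one h3).2 h2
  have h5 : 0 ≤ apxSymb κ i / eigVal i := div_nonneg (by linarith) h3.le
  exact ⟨by unfold symbErr; linarith, by unfold symbErr; linarith⟩

lemma tendsto_symbErr {i : ℤ × (Fin n → ℤ)} (hi : i.1 ≠ 0) :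
    Tendsto (fun N : ℕ => symbErr ((N : ℝ) + 1) i) atTop (𝓝 0) := by
  have h := ((tendsto_apxSymb i).div_const (eigVal i)).const_sub 1
  rwa [div_self (eigVal_pos hi).ne', sub_self] at h

/-- The energy estimate for a single mode in the dual norm adapted to the approximation. -/
lemma mode_energy_estimate {κ : ℝ} (hκ : 1 ≤ κ) {s t : ℝ} (hst : s ≤ t) {v w p : ℝ × Cyl n → ℝ}
    (hv : BddMeas v) (hw : BddMeas w) (hp : BddMeas p) {C : ℝ} (hC : 0 < C)
    {i : ℤ × (Fin n → ℤ)} (hi : i.1 ≠ 0)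
    (hweq : ∀ r ∈ Icc s t, coef i (fun u => w (r, u)) = coef i (fun u => w (s, u)) -
      eigVal i * ∫ q in s..r, coef i (fun u => v (q, u) * w (q, u)))
    (hpeq : ∀ r ∈ Icc s t, coef i (fun u => p (r, u)) = coef i (fun u => w (s, u)) -
      apxSymb κ i * ∫ q in s..r, coef i (fun u => v (q, u) * p (q, u))) :
    ∫ r in s..t, ((coef i (fun u => p (r, u) - w (r, u))).re *
        (coef i (fun u => v (r, u) * (p (r, u) - w (r, u)))).re +
      (coef i (fun u => p (r, u) - w (r, u))).im *
        (coef i (fun u => v (r, u) * (p (r, u) - w (r, u)))).im) ≤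
      symbErr κ i ^ 2 * (‖coef i (fun u => w (s, u))‖ ^ 2 +
        C / 2 * ∫ r in s..t, ‖coef i (fun u => w (r, u))‖ ^ 2) +
      1 / (2 * C) * ∫ r in s..t, ‖coef i (fun u => v (r, u) * (p (r, u) - w (r, u)))‖ ^ 2 := by
  set a := apxSymb κ i with ha
  set δ := symbErr κ i with hδ
  have ha2 : 1 / 2 ≤ a := one_half_le_apxSymb hκ hi
  have hl := eigVal_pos hi
  have hδa : (1 - δ) * eigVal i = a := by
    rw [hδ, symbErr, sub_sub_cancel, div_mul_cancel₀ _ hl.ne']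
  have hd := hp.sub hw
  have hz := hv.mul hd
  set W : ℝ → ℂ := fun r => coef i (fun u => w (r, u)) with hW
  set d : ℝ → ℂ := fun r => coef i (fun u => p (r, u) - w (r, u)) with hddef
  set z : ℝ → ℂ := fun r => coef i (fun u => v (r, u) * (p (r, u) - w (r, u))) with hzdef
  set f : ℝ → ℂ := fun r => d r + δ * W r with hf
  have hdW : ∀ r, d r = coef i (fun u => p (r, u)) - W r := fun r =>
    coef_sub (hp.section_right r) (hw.section_right r) i
  have hzi : ∀ a b, IntervalIntegrable z volume a b := intervalIntegrable_coef hz i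
  have hps : coef i (fun u => p (s, u)) = W s := by
    rw [hpeq s (left_mem_Icc.2 hst)]; simp [hW]
  have hfs : f s = δ * W s := by simp only [hf]; rw [hdW, hps]; ring
  have hfeq : ∀ r ∈ Icc s t, f r = f s + ∫ q in s..r, -(a : ℂ) * z q := by
    intro r hr
    have e1 : ∫ q in s..r, z q = (∫ q in s..r, coef i (fun u => v (q, u) * p (q, u))) -
        ∫ q in s..r, coef i (fun u => v (q, u) * w (q, u)) := by
      rw [← intervalIntegral.integral_sub (intervalIntegrable_coef (hv.mul hp) i _ _)
        (intervalIntegrable_coef (hv.mul hw) i _ _)]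
      refine intervalIntegral.integral_congr fun q _ => ?_
      simp only [hzdef, mul_sub]
      exact coef_sub ((hv.section_right q).mul (hp.section_right q))
        ((hv.section_right q).mul (hw.section_right q)) i
    rw [intervalIntegral.integral_const_mul, e1, hfs]
    simp only [hf]
    rw [hdW, hpeq r hr]
    have e2 : W r = W s - eigVal i * ∫ q in s..r, coef i (fun u => v (q, u) * w (q, u)) := hweq r hr
    have e3 : ((1 : ℂ) - δ) * eigVal i = a := by exact_mod_cast hδa
    rw [e2, ← e3]
    ring
  have henergy := integral_energy hst ((hzi s t).const_mul (-(a : ℂ))) hfeq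
  have hdz := intervalIntegrable_coef_mul hd hz i s t
  have hWz := intervalIntegrable_coef_mul hw hz i s t
  have hW2 := intervalIntegrable_coef_sq hw i s t
  have hz2 := intervalIntegrable_coef_sq hz i s t
  have hfz : IntervalIntegrable (fun q => (f q).re * (z q).re + (f q).im * (z q).im) volume s t := by
    refine (hdz.add (hWz.const_mul δ)).congr (fun q _ => ?_)
    simp only [hf, Complex.add_re, Complex.add_im, Complex.re_ofReal_mul, Complex.im_ofReal_mul]
    ring
  have e4 : ∫ q in s..t, 2 * ((f q).re * (-(a : ℂ) * z q).re + (f q).im * (-(a : ℂ) * z q).im) =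
      -2 * a * ∫ q in s..t, ((f q).re * (z q).re + (f q).im * (z q).im) := by
    rw [← intervalIntegral.integral_const_mul]
    refine intervalIntegral.integral_congr fun q _ => ?_
    simp only [neg_mul, Complex.neg_re, Complex.neg_im, Complex.re_ofReal_mul,
      Complex.im_ofReal_mul]
    ring
  rw [e4] at henergy
  -- The energy identity reads ‖f(t)‖² - ‖f(s)‖² = -2a∫ Re(f z̄). Dropping ‖f(t)‖² and using 2a ≥ 1
  -- bounds the integral by ‖f(s)‖², where f(s) = δW(s) because p and w have the same coefficient at
  -- time s.
  have e5 : ∫ q in s..t, ((f q).re * (z q).re + (f q).im * (z q).im) ≤ δ ^ 2 * ‖W s‖ ^ 2 := by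
    have h1 : ‖f s‖ ^ 2 = δ ^ 2 * ‖W s‖ ^ 2 := by
      rw [hfs, norm_mul, Complex.norm_real, mul_pow, Real.norm_eq_abs, sq_abs]
    rw [← h1]
    by_contra hcon
    push Not at hcon
    nlinarith [sq_nonneg ‖f t‖, sq_nonneg ‖f s‖]
  have e6 : ∫ r in s..t, ((d r).re * (z r).re + (d r).im * (z r).im) ≤
      ∫ r in s..t, (((f r).re * (z r).re + (f r).im * (z r).im) +
        (δ ^ 2 * (C / 2) * ‖W r‖ ^ 2 + 1 / (2 * C) * ‖z r‖ ^ 2)) := by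
    refine intervalIntegral.integral_mono_on hst hdz
      (hfz.add ((hW2.const_mul _).add (hz2.const_mul _))) fun r _ => ?_
    have h1 : (d r).re = (f r).re - δ * (W r).re := by simp [hf]
    have h2 : (d r).im = (f r).im - δ * (W r).im := by simp [hf]
    rw [h1, h2, Complex.sq_norm, Complex.sq_norm, Complex.normSq_apply, Complex.normSq_apply]
    -- Young's inequality. The weight 1/(2C) is such that, for 0 ≤ v ≤ C, the sum over modes of the
    -- z-terms can be absorbed into the left-hand side.
    have h3 : ∀ x y : ℝ, -(δ * x * y) ≤ δ ^ 2 * (C / 2) * (x * x) + 1 / (2 * C) * (y * y) := by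
      intro x y
      have : δ ^ 2 * (C / 2) * (x * x) + 1 / (2 * C) * (y * y) + δ * x * y =
          1 / (2 * C) * (C * δ * x + y) ^ 2 := by field_simp; ring
      have h4 : 0 ≤ 1 / (2 * C) * (C * δ * x + y) ^ 2 := by positivity
      linarith
    linarith [h3 (W r).re (z r).re, h3 (W r).im (z r).im]
  rw [intervalIntegral.integral_add hfz ((hW2.const_mul _).add (hz2.const_mul _)),
    intervalIntegral.integral_add (hW2.const_mul _) (hz2.const_mul _),
    intervalIntegral.integral_const_mul, intervalIntegral.integral_const_mul] at e6
  linarith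

/-- Comparison with `0` in the layer, almost everywhere in space-time. -/
lemma ae_layer_nonpos {s t : ℝ} (hst : s ≤ t) {v w : ℝ × Cyl n → ℝ} (hv : BddMeas v)
    (hw : BddMeas w) {c C : ℝ} (hc : 0 < c) (hvc : ∀ p, c ≤ v p) (hvC : ∀ p, v p ≤ C)
    (hweq : ∀ i, ∀ r ∈ Icc s t, coef i (fun u => w (r, u)) = coef i (fun u => w (s, u)) -
      eigVal i * ∫ q in s..r, coef i (fun u => v (q, u) * w (q, u)))
    (h0 : ∀ᵐ u ∂(volume.restrict (Omega n)), w (s, u) ≤ 0) :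
    ∀ᵐ p ∂layerMeasure n s t, w p ≤ 0 := by
  have hC : 0 < C := hc.trans_le ((hvc 0).trans (hvC 0))
  -- Truncation makes the datum nonpositive at every point, as the evolution lemma requires, without
  -- changing its coefficients.
  set p₀ : Cyl n → ℝ := fun u => min (w (s, u)) 0 with hp₀
  have hp₀b : BddMeas p₀ := by
    obtain ⟨K, hK⟩ := hw.bdd
    refine ⟨(hw.section_right s).meas.min measurable_const, K, fun u => ?_⟩
    refine le_trans ?_ (hK (s, u))
    simp only [hp₀]
    rcases le_total (w (s, u)) 0 with h | h
    · rw [min_eq_left h]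
    · rw [min_eq_right h, abs_zero]; exact abs_nonneg _
  have hp₀w : p₀ =ᵐ[volume.restrict (Omega n)] fun u => w (s, u) :=
    h0.mono fun u hu => min_eq_left hu
  -- The summable majorant, independent of κ. It vanishes for k = 0, where `symbErr_mem` gives no
  -- control.
  set g : ℤ × (Fin n → ℤ) → ℝ := fun i => ‖coef i (fun u => w (s, u))‖ ^ 2 +
        C / 2 * ∫ r in s..t, ‖coef i (fun u => w (r, u))‖ ^ 2 with hg
  have hgs : Summable g := (hasSum_coef_sq (hw.section_right s)).summable.add
    ((hasSum_integral_coef_sq_layer hw hst).summable.mul_left _)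
  have hg0 : ∀ i, 0 ≤ g i := fun i => add_nonneg (by positivity)
    (mul_nonneg (by positivity) (intervalIntegral.integral_nonneg hst fun r _ => by positivity))
  have hgz : ∀ i : ℤ × (Fin n → ℤ), i.1 = 0 → g i = 0 := fun i hi => by
    simp [hg, coef_eq_zero hi]
  have hgb : ∀ (N : ℕ) i, ‖symbErr ((N : ℝ) + 1) i ^ 2 * g i‖ ≤ g i := by
    intro N i
    by_cases hi : i.1 = 0
    · simp [hgz i hi]
    · have := symbErr_mem (κ := (N : ℝ) + 1) (by simp) hi
      rw [norm_mul, Real.norm_of_nonneg (hg0 i), Real.norm_of_nonneg (sq_nonneg _)]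
      exact mul_le_of_le_one_left (hg0 i) (pow_le_one₀ this.1 this.2)
  have hεlim : Tendsto (fun N : ℕ => ∑' i, symbErr ((N : ℝ) + 1) i ^ 2 * g i) atTop (𝓝 0) := by
    have h := tendsto_tsum_of_dominated_convergence (𝓕 := atTop)
      (f := fun (N : ℕ) i => symbErr ((N : ℝ) + 1) i ^ 2 * g i) (g := fun _ => (0 : ℝ)) hgs
      (fun i => ?_) (Eventually.of_forall fun N i => hgb N i)
    · simpa using h
    · by_cases hi : i.1 = 0
      · simp [hgz i hi]
      · simpa using ((tendsto_symbErr hi).pow 2).mul_const (g i)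
  set wp : ℝ × Cyl n → ℝ := fun z => max (w z) 0 with hwp
  have hwpb : BddMeas wp := by
    obtain ⟨K, hK⟩ := hw.bdd
    refine ⟨hw.meas.max measurable_const, K, fun z => ?_⟩
    refine le_trans ?_ (hK z)
    simp only [hwp]
    rcases le_total (w z) 0 with h | h
    · rw [max_eq_right h, abs_zero]; exact abs_nonneg _
    · rw [max_eq_left h]
  have hbound : ∀ N : ℕ, c * ∫ z, wp z * wp z ∂layerMeasure n s t ≤
      ∑' i, symbErr ((N : ℝ) + 1) i ^ 2 * g i := by
    intro N
    set κ : ℝ := (N : ℝ) + 1 with hκd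
    have hκ : 1 ≤ κ := by simp [hκd]
    have hκ0 : 0 < κ := by linarith
    obtain ⟨p, hpb, hpneg, hpeq⟩ := exists_nonpos_apxLap_evolution hκ0 hv
      (fun z => hc.le.trans (hvc z)) hp₀b (fun u => min_le_right _ _) hst
    have hvp := hv.mul hpb
    have hLb : BddMeas fun z : ℝ × Cyl n => apxLap κ (fun u' => v (z.1, u') * p (z.1, u')) z.2 :=
      (bddMeas_posOp κ hvp).sub (hvp.const_mul _)
    have hpcoef : ∀ i, ∀ r ∈ Icc s t, coef i (fun u => p (r, u)) = coef i (fun u => w (s, u)) -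
        apxSymb κ i * ∫ q in s..r, coef i (fun u => v (q, u) * p (q, u)) := by
      intro i r hr
      have hib : BddMeas fun u => ∫ q in s..r, apxLap κ (fun u' => v (q, u') * p (q, u')) u := by
        have h := (hpb.section_right r).sub hp₀b
        simpa only [hpeq r hr, add_sub_cancel_left] using h
      simp_rw [hpeq r hr]
      rw [coef_add hp₀b hib, coef_congr_ae hp₀w, coef_integral hLb hr.1, sub_eq_add_neg,
        ← neg_mul, ← intervalIntegral.integral_const_mul]
      congr 1
      refine intervalIntegral.integral_congr fun q _ => ?_
      exact coef_apxLap hκ0 (hvp.section_right q) i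
    have hd := hpb.sub hw
    have hz := hv.mul hd
    have hsum1 := hasSum_integral_coef_mul hd hz hst
    have hsum2 := ((hgs.of_norm_bounded (fun i => hgb N i)).hasSum).add
      ((hasSum_integral_coef_sq_layer hz hst).mul_left (1 / (2 * C)))
    -- With d = p - w, the summed estimates read 2∫∫ v d² ≤ ε + (1/C)∫∫ v² d². As v ≤ C, the last
    -- term is at most ∫∫ v d², which leaves ∫∫ v d² ≤ ε.
    have hle := hasSum_le (fun i => ?_) hsum1 hsum2
    · have hz2 : ∫ z, (v z * (p z - w z)) ^ 2 ∂layerMeasure n s t ≤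
          C * ∫ z, (p z - w z) * (v z * (p z - w z)) ∂layerMeasure n s t := by
        rw [← integral_const_mul]
        refine integral_mono (by simpa only [sq] using (hz.mul hz).integrable _)
          (((hd.mul hz).const_mul C).integrable _) fun z => ?_
        have h1 := hvC z
        have h2 : 0 ≤ v z * (p z - w z) ^ 2 := mul_nonneg (hc.le.trans (hvc z)) (sq_nonneg _)
        simp only
        nlinarith
      have h3 : 1 / (2 * C) * (2 * ∫ z, (v z * (p z - w z)) ^ 2 ∂layerMeasure n s t) ≤
          ∫ z, (p z - w z) * (v z * (p z - w z)) ∂layerMeasure n s t := by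
        rw [show 1 / (2 * C) * (2 * ∫ z, (v z * (p z - w z)) ^ 2 ∂layerMeasure n s t) =
          (∫ z, (v z * (p z - w z)) ^ 2 ∂layerMeasure n s t) / C by field_simp, div_le_iff₀ hC]
        linarith
      have h4 : c * ∫ z, wp z * wp z ∂layerMeasure n s t ≤
          ∫ z, (p z - w z) * (v z * (p z - w z)) ∂layerMeasure n s t := by
        rw [← integral_const_mul]
        refine integral_mono (((hwpb.mul hwpb).const_mul c).integrable _)
          ((hd.mul hz).integrable _) fun z => ?_
        -- Where w > 0, the sign p ≤ 0 puts p at distance at least w from w.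
        have h5 : wp z * wp z ≤ (p z - w z) * (p z - w z) := by
          simp only [hwp]
          rcases le_total (w z) 0 with h | h
          · rw [max_eq_right h]; nlinarith [mul_self_nonneg (p z - w z)]
          · rw [max_eq_left h]; nlinarith [hpneg z]
        have h6 := hvc z
        simp only
        nlinarith [mul_self_nonneg (wp z)]
      linarith
    · by_cases hi : i.1 = 0
      · simp [coef_eq_zero hi, hgz i hi]
      · exact mode_energy_estimate hκ hst hv hw hpb hC hi (hweq i) (hpcoef i)
  have hzero : ∫ z, wp z * wp z ∂layerMeasure n s t = 0 := by
    have h1 := ge_of_tendsto' hεlim hbound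
    have h2 : 0 ≤ ∫ z, wp z * wp z ∂layerMeasure n s t := integral_nonneg fun z => mul_self_nonneg _
    nlinarith
  rw [integral_eq_zero_iff_of_nonneg (fun z => mul_self_nonneg _) ((hwpb.mul hwpb).integrable _)]
    at hzero
  filter_upwards [hzero] with z hz
  have : wp z = 0 := mul_self_eq_zero.1 hz
  exact (le_max_left _ _).trans this.le

/-! ### From almost every time to a given time -/

/-- Nonpositivity passes to weak limits, expressed through the mode coefficients. -/
lemma ae_nonpos_of_frequently {w : ℝ × Cyl n → ℝ} (hw : BddMeas w) {l : Filter ℝ} {t : ℝ}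
    (hlim : ∀ i, Tendsto (fun r => coef i (fun u => w (r, u))) l (𝓝 (coef i fun u => w (t, u))))
    (hfreq : ∃ᶠ r in l, ∀ᵐ u ∂(volume.restrict (Omega n)), w (r, u) ≤ 0) :
    ∀ᵐ u ∂(volume.restrict (Omega n)), w (t, u) ≤ 0 := by
  obtain ⟨K, hK⟩ := hw.bdd
  set ψ : Cyl n → ℝ := fun u => max (w (t, u)) 0 with hψ
  have hψb : BddMeas ψ := by
    refine ⟨(hw.section_right t).meas.max measurable_const, K, fun u => ?_⟩
    refine le_trans ?_ (hK (t, u))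
    simp only [hψ]
    rcases le_total (w (t, u)) 0 with h | h
    · rw [max_eq_right h, abs_zero]; exact abs_nonneg _
    · rw [max_eq_left h]
  set I : ℝ := ∫ u in Omega n, ψ u * ψ u with hI
  set M : ℝ := ∫ _ in Omega n, K ^ 2 with hM
  have hexp : ∀ (Λ : ℝ) (f : Cyl n → ℝ), BddMeas f → ∫ u in Omega n, (Λ * ψ u + f u) ^ 2 =
      Λ ^ 2 * I + 2 * Λ * (∫ u in Omega n, ψ u * f u) + ∫ u in Omega n, f u * f u := by
    intro Λ f hf
    have : ∀ u, (Λ * ψ u + f u) ^ 2 = Λ ^ 2 * (ψ u * ψ u) + 2 * Λ * (ψ u * f u) + f u * f u :=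
      fun u => by ring
    simp_rw [this]
    rw [integral_add ((((hψb.mul hψb).const_mul _).add ((hψb.mul hf).const_mul _)).integrable _)
      ((hf.mul hf).integrable _), integral_add (((hψb.mul hψb).const_mul _).integrable _)
      (((hψb.mul hf).const_mul _).integrable _), integral_const_mul, integral_const_mul]
  -- When w(r) ≤ 0 the cross term with ψ ≥ 0 is nonpositive, so ‖Λψ + w(r)‖² ≤ Λ²I + M. Finite
  -- Parseval sums carry this bound to time t, where the cross term equals 2ΛI because ψ is the
  -- positive part of w(t). Large Λ then forces I = 0.
  have key : ∀ Λ : ℝ, 0 < Λ → 2 * Λ * I ≤ M := by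
    intro Λ hΛ
    have hb : ∀ r, BddMeas fun u => Λ * ψ u + w (r, u) := fun r =>
      (hψb.const_mul Λ).add (hw.section_right r)
    have hfin : ∀ S : Finset (ℤ × (Fin n → ℤ)),
        ∑ i ∈ S, ‖coef i (fun u => Λ * ψ u + w (t, u))‖ ^ 2 ≤ 2 * (Λ ^ 2 * I + M) := by
      intro S
      have hlimS : Tendsto (fun r => ∑ i ∈ S, ‖coef i (fun u => Λ * ψ u + w (r, u))‖ ^ 2) l
          (𝓝 (∑ i ∈ S, ‖coef i (fun u => Λ * ψ u + w (t, u))‖ ^ 2)) := by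
        refine tendsto_finsetSum _ fun i _ => ?_
        have e : ∀ r, coef i (fun u => Λ * ψ u + w (r, u)) =
            coef i (fun u => Λ * ψ u) + coef i (fun u => w (r, u)) := fun r =>
          coef_add (hψb.const_mul Λ) (hw.section_right r) i
        simp_rw [e]
        exact (((hlim i).const_add _).norm).pow 2
      refine le_of_tendsto_of_frequently hlimS (hfreq.mono fun r hr => ?_)
      refine (sum_le_hasSum S (fun i _ => by positivity) (hasSum_coef_sq (hb r))).trans ?_
      rw [hexp Λ _ (hw.section_right r)]
      have h1 : ∫ u in Omega n, ψ u * w (r, u) ≤ 0 := integral_nonpos_of_ae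
        (hr.mono fun u hu => mul_nonpos_of_nonneg_of_nonpos (le_max_right _ _) hu)
      have h2 : ∫ u in Omega n, w (r, u) * w (r, u) ≤ M :=
        integral_mono (((hw.section_right r).mul (hw.section_right r)).integrable _)
          (integrable_const _) fun u => by
            simp only
            rw [← abs_mul_abs_self, ← sq]
            gcongr
            exact hK _
      have h3 : 2 * Λ * ∫ u in Omega n, ψ u * w (r, u) ≤ 0 :=
        mul_nonpos_of_nonneg_of_nonpos (by positivity) h1
      linarith
    have h4 := hasSum_le_of_sum_le (hasSum_coef_sq (hb t)) hfin
    rw [hexp Λ _ (hw.section_right t)] at h4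
    have h5 : ∫ u in Omega n, ψ u * w (t, u) = I := by
      refine integral_congr_ae (Eventually.of_forall fun u => ?_)
      simp only [hψ]
      rcases le_total (w (t, u)) 0 with h | h
      · simp [max_eq_right h]
      · simp [max_eq_left h]
    have h6 : 0 ≤ ∫ u in Omega n, w (t, u) * w (t, u) := integral_nonneg fun u => mul_self_nonneg _
    rw [h5] at h4
    linarith
  have hI0 : 0 ≤ I := integral_nonneg fun u => mul_self_nonneg _
  have hIz : I = 0 := by
    by_contra hne
    have hpos : 0 < I := lt_of_le_of_ne hI0 (Ne.symm hne)
    have hM0 : 0 ≤ M := integral_nonneg fun u => sq_nonneg _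
    have := key ((M + 1) / I) (by positivity)
    rw [mul_assoc, div_mul_cancel₀ _ hne] at this
    linarith
  rw [hI, integral_eq_zero_iff_of_nonneg (fun z => mul_self_nonneg _)
    ((hψb.mul hψb).integrable _)] at hIz
  filter_upwards [hIz] with u hu
  have : ψ u = 0 := mul_self_eq_zero.1 hu
  exact (le_max_left _ _).trans this.le

/-- The comparison principle for the linear equation `∂_t w = Δ (v w)` in mode form. -/
lemma ae_nonpos_of_mode_equation {s t : ℝ} (hst : s < t) {v w : ℝ × Cyl n → ℝ} (hv : BddMeas v)
    (hw : BddMeas w) {c C : ℝ} (hc : 0 < c) (hvc : ∀ p, c ≤ v p) (hvC : ∀ p, v p ≤ C)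
    (hweq : ∀ i, ∀ r ∈ Icc s t, coef i (fun u => w (r, u)) = coef i (fun u => w (s, u)) -
      eigVal i * ∫ q in s..r, coef i (fun u => v (q, u) * w (q, u)))
    (h0 : ∀ᵐ u ∂(volume.restrict (Omega n)), w (s, u) ≤ 0) :
    ∀ᵐ u ∂(volume.restrict (Omega n)), w (t, u) ≤ 0 := by
  have h1 := ae_layer_nonpos hst.le hv hw hc hvc hvC hweq h0
  have h2 := Measure.ae_ae_of_ae_prod h1
  refine ae_nonpos_of_frequently (l := 𝓝[Ioo s t] t) hw (fun i => ?_) ?_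
  · have hcont : ContinuousOn (fun r => coef i (fun u => w (s, u)) -
        eigVal i * ∫ q in s..r, coef i (fun u => v (q, u) * w (q, u))) (Icc s t) := by
      have := intervalIntegral.continuousOn_primitive_interval'
        (intervalIntegrable_coef (hv.mul hw) i s t) left_mem_uIcc
      rw [uIcc_of_le hst.le] at this
      exact continuousOn_const.sub (continuousOn_const.mul this)
    have hcont2 : ContinuousOn (fun r => coef i (fun u => w (r, u))) (Icc s t) :=
      hcont.congr (hweq i)
    exact (hcont2 t (right_mem_Icc.2 hst.le)).mono_left (nhdsWithin_mono _ Ioo_subset_Icc_self)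
  · intro hev
    rw [eventually_nhdsWithin_iff, eventually_iff_exists_mem] at hev
    obtain ⟨U, hU, hbad⟩ := hev
    -- If the sign failed at all times just before t, the interval (max a s, t) would be contained
    -- in the exceptional null set.
    obtain ⟨a, ha, haU⟩ := exists_Ioc_subset_of_mem_nhds hU ⟨s, hst⟩
    rw [ae_restrict_iff' measurableSet_Ioc] at h2
    have h3 : ∀ᵐ r : ℝ, r ∉ Ioo (max a s) t := by
      filter_upwards [h2] with r hr hmem
      exact hbad r (haU ⟨(le_max_left _ _).trans_lt hmem.1, hmem.2.le⟩)
        ⟨(le_max_right _ _).trans_lt hmem.1, hmem.2⟩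
        (hr ⟨(le_max_right _ _).trans_lt hmem.1, hmem.2.le⟩)
    have h4 : volume (Ioo (max a s) t) = 0 := by
      have := measure_eq_zero_iff_ae_notMem.2 h3
      exact this
    rw [Real.volume_Ioo, ENNReal.ofReal_eq_zero] at h4
    have := max_lt ha hst
    linarith

/-! ### The modes as test functions -/

/-- A product of an axial function and the real part of a character of the torus. -/
def prodFn (g : ℝ → ℝ) (m : Fin n → ℤ) (c : ℂ) (u : Cyl n) : ℝ :=
  g u.1 * (c * UnitAddTorus.mFourier m u.2).re

/-- The effect of a partial derivative on the axial factor. -/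
def axDeriv (i : Fin (n + 1)) (g : ℝ → ℝ) : ℝ → ℝ :=
  Fin.cases (motive := fun _ => ℝ → ℝ) (deriv g) (fun _ => g) i

/-- The effect of a partial derivative on the coefficient of the character. -/
def torDeriv (i : Fin (n + 1)) (m : Fin n → ℤ) (c : ℂ) : ℂ :=
  Fin.cases (motive := fun _ => ℂ) c (fun j => c * (2 * Real.pi * m j * Complex.I)) i

lemma zero_mem_lineSet {u : Cyl n} (hu : u ∈ OmegaBar n) (i : Fin (n + 1)) : 0 ∈ lineSet i u := by
  have : shift i 0 = (0 : Cyl n) := by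
    refine Fin.cases ?_ (fun j => ?_) i
    · simp [shift]
    · simp [shift]
  simpa [lineSet, this] using hu

/-- Axially the line set is a nondegenerate interval, in torus directions the whole line; this makes
`derivWithin` computable up to the boundary. -/
lemma uniqueDiff_lineSet {u : Cyl n} (hu : u ∈ OmegaBar n) (i : Fin (n + 1)) :
    UniqueDiffWithinAt ℝ (lineSet i u) 0 := by
  have h0 := zero_mem_lineSet hu i
  revert h0
  refine Fin.cases (fun h0 => ?_) (fun j h0 => ?_) i
  · have e : lineSet (0 : Fin (n + 1)) u = Icc (-1 - u.1) (1 - u.1) := by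
      ext h
      simp only [lineSet, shift, OmegaBar, Fin.cases_zero, mem_ofPred_eq, Prod.fst_add, mem_Icc]
      constructor <;> rintro ⟨h1, h2⟩ <;> constructor <;> linarith
    rw [e] at h0 ⊢
    exact uniqueDiffOn_Icc (by linarith) 0 h0
  · have e : lineSet j.succ u = univ := by
      ext h
      simp only [lineSet, shift, OmegaBar, Fin.cases_succ, mem_ofPred_eq, Prod.fst_add, add_zero,
        mem_univ, iff_true]
      exact hu
    rw [e]
    exact uniqueDiffWithinAt_univ

/-- The family `prodFn` is closed under partial derivatives, the complex coefficient absorbing the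
factors 2πi m_j. Every derivative required by `IsTest` is thereby explicit. -/
lemma hasDerivWithinAt_prodFn {g : ℝ → ℝ} (hg : Differentiable ℝ g) (m : Fin n → ℤ) (c : ℂ)
    (i : Fin (n + 1)) (u : Cyl n) :
    HasDerivWithinAt (fun h => prodFn g m c (u + shift i h))
      (prodFn (axDeriv i g) m (torDeriv i m c) u) (lineSet i u) 0 := by
  refine HasDerivAt.hasDerivWithinAt ?_
  refine Fin.cases ?_ (fun j => ?_) i
  · simp only [prodFn, shift, axDeriv, torDeriv, Fin.cases_zero, Prod.fst_add, Prod.snd_add,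
      add_zero]
    have h1 : HasDerivAt (fun h => g (u.1 + h)) (deriv g u.1) 0 := by
      have : HasDerivAt g (deriv g u.1) (u.1 + 0) := by rw [add_zero]; exact (hg u.1).hasDerivAt
      exact HasDerivAt.comp_const_add u.1 0 this
    exact h1.mul_const _
  · simp only [prodFn, shift, axDeriv, torDeriv, Fin.cases_succ, Prod.fst_add, Prod.snd_add,
      add_zero, mFourier_add_arg, mFourier_single_arg]
    have h1 : HasDerivAt (fun h : ℝ => Complex.exp (2 * Real.pi * m j * h * Complex.I))
        (2 * Real.pi * m j * Complex.I) 0 := by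
      have h2 : HasDerivAt (fun h : ℝ => (2 * Real.pi * m j * h * Complex.I : ℂ))
          (2 * Real.pi * m j * Complex.I) 0 := by
        have := ((Complex.ofRealCLM.hasDerivAt (x := (0 : ℝ))).const_mul
          (2 * Real.pi * m j : ℂ)).mul_const Complex.I
        simpa using this
      simpa using h2.cexp
    have h3 := (h1.const_mul (c * UnitAddTorus.mFourier m u.2))
    have h4 := (Complex.reCLM.hasFDerivAt.comp_hasDerivAt (0 : ℝ) h3).const_mul (g u.1)
    refine (h4.congr_deriv ?_).congr_of_eventuallyEq (Eventually.of_forall fun h => ?_)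
    · simp only [Complex.reCLM_apply]
      congr 2; ring
    · simp only [Function.comp, Complex.reCLM_apply, mul_assoc]

lemma partialD_prodFn {g : ℝ → ℝ} (hg : Differentiable ℝ g) (m : Fin n → ℤ) (c : ℂ)
    (i : Fin (n + 1)) {u : Cyl n} (hu : u ∈ OmegaBar n) :
    partialD i (prodFn g m c) u = prodFn (axDeriv i g) m (torDeriv i m c) u :=
  (hasDerivWithinAt_prodFn hg m c i u).derivWithin (uniqueDiff_lineSet hu i)

lemma hasPartial_congr {f g : Cyl n → ℝ} (h : EqOn f g (OmegaBar n)) {i : Fin (n + 1)}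
    (hg : HasPartial i g) : HasPartial i f := fun u hu =>
  (hg u hu).congr (fun _ hr => h hr) (h (zero_mem_lineSet hu i))

/-- Needed for second derivatives: the formula for the first one is available only on `OmegaBar`,
and the line sets never leave it. -/
lemma partialD_congr {f g : Cyl n → ℝ} (h : EqOn f g (OmegaBar n)) (i : Fin (n + 1)) {u : Cyl n}
    (hu : u ∈ OmegaBar n) : partialD i f u = partialD i g u :=
  derivWithin_congr (fun _ hr => h hr) (h (zero_mem_lineSet hu i))

lemma hasPartial_prodFn {g : ℝ → ℝ} (hg : Differentiable ℝ g) (m : Fin n → ℤ) (c : ℂ)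
    (i : Fin (n + 1)) : HasPartial i (prodFn g m c) := fun u _ =>
  (hasDerivWithinAt_prodFn hg m c i u).differentiableWithinAt

lemma continuous_prodFn {g : ℝ → ℝ} (hg : Continuous g) (m : Fin n → ℤ) (c : ℂ) :
    Continuous (prodFn g m c) := by
  unfold prodFn
  exact (hg.comp continuous_fst).mul (Complex.continuous_re.comp (continuous_const.mul
    ((UnitAddTorus.mFourier m).continuous.comp continuous_snd)))

lemma contDiff_axDeriv {g : ℝ → ℝ} (hg : ContDiff ℝ ((⊤ : ℕ∞) : WithTop ℕ∞) g) (i : Fin (n + 1)) :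
    ContDiff ℝ ((⊤ : ℕ∞) : WithTop ℕ∞) (axDeriv i g) := by
  refine Fin.cases ?_ (fun j => ?_) i
  · exact (contDiff_infty_iff_deriv.1 hg).2
  · exact hg

lemma differentiable_of_contDiff_infty {g : ℝ → ℝ} (hg : ContDiff ℝ ((⊤ : ℕ∞) : WithTop ℕ∞) g) :
    Differentiable ℝ g := hg.differentiable (by simp)

lemma contBar_of_eqOn {T : ℝ} {G : ℝ → Cyl n → ℝ} {F : Cyl n → ℝ} (hF : Continuous F)
    (h : ∀ t, EqOn (G t) F (OmegaBar n)) : ContBar T G :=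
  (hF.comp continuous_snd).continuousOn.congr fun p hp => h p.1 hp.2

/-- Time independent products vanishing on the boundary are admissible test functions. -/
lemma isTest_prodFn {g : ℝ → ℝ} (hg : ContDiff ℝ ((⊤ : ℕ∞) : WithTop ℕ∞) g) (h1 : g 1 = 0)
    (h2 : g (-1) = 0) (m : Fin n → ℤ) (c : ℂ) (T : ℝ) : IsTest T (fun _ => prodFn g m c) where
  cont := contBar_of_eqOn (continuous_prodFn hg.continuous m c) fun _ _ _ => rfl
  time_diff := fun _ _ => differentiableOn_const _
  time_cont := contBar_of_eqOn (F := fun _ => 0) continuous_const fun t u _ => by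
    simp [timeD]
  space_diff := fun i _ _ => hasPartial_prodFn (differentiable_of_contDiff_infty hg) m c i
  space_cont := fun i => contBar_of_eqOn
    (continuous_prodFn (contDiff_axDeriv hg i).continuous m (torDeriv i m c)) fun _ _ hu =>
      partialD_prodFn (differentiable_of_contDiff_infty hg) m c i hu
  space_diff₂ := fun i j _ _ => hasPartial_congr
    (fun _ hu => partialD_prodFn (differentiable_of_contDiff_infty hg) m c j hu)
    (hasPartial_prodFn (differentiable_of_contDiff_infty (contDiff_axDeriv hg j)) m _ i)
  space_cont₂ := fun i j => contBar_of_eqOn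
    (continuous_prodFn (contDiff_axDeriv (contDiff_axDeriv hg j) i).continuous m
      (torDeriv i m (torDeriv j m c))) fun _ _ hu =>
      (partialD_congr (fun _ hu' => partialD_prodFn (differentiable_of_contDiff_infty hg) m c j hu')
        i hu).trans (partialD_prodFn
          (differentiable_of_contDiff_infty (contDiff_axDeriv hg j)) m _ i hu)
  boundary := fun _ _ u hu => by
    rcases hu with hu | hu <;> simp [prodFn, hu, h1, h2]

lemma contDiff_axMode (k : ℤ) : ContDiff ℝ ((⊤ : ℕ∞) : WithTop ℕ∞) (axMode k) := by
  unfold axMode; fun_prop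

lemma axMode_one (k : ℤ) : axMode k 1 = 0 := by
  rw [axMode, show Real.pi * k * (1 + 1) / 2 = k * Real.pi by ring]; exact Real.sin_int_mul_pi k

lemma axMode_neg_one (k : ℤ) : axMode k (-1) = 0 := by simp [axMode]

lemma deriv_deriv_axMode (k : ℤ) (x : ℝ) :
    deriv (deriv (axMode k)) x = -(Real.pi * k / 2) ^ 2 * axMode k x := by
  have h0 : ∀ x : ℝ, HasDerivAt (fun x : ℝ => Real.pi * k * (x + 1) / 2) (Real.pi * k / 2) x :=
    fun x => by
      simpa using ((((hasDerivAt_id x).add_const 1).const_mul (Real.pi * k)).div_const 2)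
  have h1 : deriv (axMode k) = fun x =>
      Real.cos (Real.pi * k * (x + 1) / 2) * (Real.pi * k / 2) :=
    funext fun x => (h0 x).sin.deriv
  rw [h1, ((h0 x).cos.mul_const _).deriv, axMode]
  ring

lemma laplacian_prodFn_axMode (i : ℤ × (Fin n → ℤ)) (c : ℂ) {u : Cyl n} (hu : u ∈ OmegaBar n) :
    laplacian (prodFn (axMode i.1) (-i.2) c) u =
      -eigVal i * prodFn (axMode i.1) (-i.2) c u := by
  have h := fun j : Fin (n + 1) => (partialD_congr (fun _ hu' => partialD_prodFn
    (differentiable_of_contDiff_infty (contDiff_axMode i.1)) (-i.2) c j hu') j hu).trans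
    (partialD_prodFn
      (differentiable_of_contDiff_infty (contDiff_axDeriv (contDiff_axMode i.1) j)) (-i.2) _ j hu)
  rw [laplacian, Finset.sum_congr rfl fun j _ => h j, Fin.sum_univ_succ, eigVal, neg_add, add_mul,
    ← Finset.sum_neg_distrib, Finset.sum_mul]
  congr 1
  · simp only [prodFn, axDeriv, torDeriv, Fin.cases_zero, deriv_deriv_axMode]
    ring
  · refine Finset.sum_congr rfl fun j _ => ?_
    simp only [prodFn, axDeriv, torDeriv, Fin.cases_succ]
    have : c * (2 * Real.pi * ((-i.2) j : ℤ) * Complex.I) *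
        (2 * Real.pi * ((-i.2) j : ℤ) * Complex.I) * UnitAddTorus.mFourier (-i.2) u.2 =
        ((-(2 * Real.pi * i.2 j) ^ 2 : ℝ) : ℂ) * (c * UnitAddTorus.mFourier (-i.2) u.2) := by
      simp only [Pi.neg_apply]
      push_cast
      linear_combination (4 * c * Real.pi ^ 2 * (i.2 j : ℂ) ^ 2 *
        UnitAddTorus.mFourier (-i.2) u.2) * Complex.I_mul_I
    rw [this, Complex.re_ofReal_mul]
    ring

/-- Test functions are real while the modes are complex; varying c recovers the whole complex
coefficient from real tests. -/
lemma integral_prodFn_mul {f : Cyl n → ℝ} (hf : BddMeas f) (i : ℤ × (Fin n → ℤ)) (c : ℂ) :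
    ∫ u in Omega n, prodFn (axMode i.1) (-i.2) c u * f u = (c * coef i f).re := by
  have h := (integrable_coef hf i).const_mul c
  rw [coef, ← integral_const_mul]
  have h2 := integral_re (𝕜 := ℂ) h
  refine Eq.trans ?_ h2
  refine integral_congr_ae (Eventually.of_forall fun u => ?_)
  have : c * ((f u : ℂ) * mode i u) =
      ((f u * axMode i.1 u.1 : ℝ) : ℂ) * (c * UnitAddTorus.mFourier (-i.2) u.2) := by
    rw [mode]; push_cast; ring
  simp only [prodFn]
  change _ = (c * ((f u : ℂ) * mode i u)).re
  rw [this, Complex.re_ofReal_mul]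
  ring

lemma Omega_subset_OmegaBar : Omega n ⊆ OmegaBar n := fun _ hu => Ioo_subset_Icc_self hu

/-! ### Comparison of weak solutions -/

/-- The weak formulation tested against a mode. -/
lemma IsWeakSolution.mode_equation {a : ℝ} {b ρ₀ : Cyl n → ℝ} {T : EReal} {ρ : ℝ → Cyl n → ℝ}
    (h : IsWeakSolution a b ρ₀ T ρ) {t : ℝ} (ht : (t : EReal) ≤ T) {R : ℝ × Cyl n → ℝ}
    (hR : BddMeas R) (hRρ : ∀ r ∈ Icc 0 t, ∀ u ∈ OmegaBar n, R (r, u) = ρ r u)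
    (i : ℤ × (Fin n → ℤ)) (c : ℂ) {r : ℝ} (hr : 0 < r) (hrt : r ≤ t) :
    (c * (coef i (fun u => R (r, u)) - coef i (fun u => R (0, u)) +
      eigVal i * ∫ q in (0 : ℝ)..r, coef i (fun u => phi a (R (q, u))))).re =
      -∫ _ in (0 : ℝ)..r, boundaryFlux a b (prodFn (axMode i.1) (-i.2) c) := by
  have hL := h.layer r hr ((EReal.coe_le_coe_iff.2 hrt).trans ht)
  have hφ : BddMeas fun z => phi a (R z) := hR.mul ((BddMeas.const 1).add (hR.const_mul a))
  have hw := hL.weak _ (isTest_prodFn (contDiff_axMode i.1) (axMode_one _) (axMode_neg_one _)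
    (-i.2) c r)
  set F := prodFn (axMode i.1) (-i.2) c with hF
  have hFb : ∀ {f : Cyl n → ℝ}, BddMeas f →
      Integrable (fun u => F u * f u) (volume.restrict (Omega n)) := by
    intro f hf
    have h1 := ((integrable_coef hf i).const_mul c).re
    refine h1.congr (Eventually.of_forall fun u => ?_)
    change (c * ((f u : ℂ) * mode i u)).re = _
    have : c * ((f u : ℂ) * mode i u) =
        ((f u * axMode i.1 u.1 : ℝ) : ℂ) * (c * UnitAddTorus.mFourier (-i.2) u.2) := by
      rw [mode]; push_cast; ring
    rw [this, Complex.re_ofReal_mul, hF]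
    simp only [prodFn]
    ring
  -- The weak formulation contains ρ₀; the initial condition trades it for ρ(0), so that
  -- coefficients at all times refer to the same function R.
  have e1 : ∫ u in Omega n, (F u * ρ r u - F u * ρ₀ u) =
      (c * coef i (fun u => R (r, u))).re - (c * coef i (fun u => R (0, u))).re := by
    rw [← integral_prodFn_mul (hR.section_right r), ← integral_prodFn_mul (hR.section_right 0),
      ← integral_sub (hFb (hR.section_right r)) (hFb (hR.section_right 0))]
    refine integral_congr_ae ?_
    filter_upwards [h.initial, ae_restrict_mem measurableSet_Omega] with u hu hu2
    rw [hRρ r ⟨hr.le, hrt⟩ u (Omega_subset_OmegaBar hu2),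
      hRρ 0 ⟨le_rfl, hr.le.trans hrt⟩ u (Omega_subset_OmegaBar hu2), hu]
  have e2 : ∫ s in (0 : ℝ)..r, ∫ u in Omega n, timeD r (fun _ => F) s u * ρ s u = 0 := by
    simp [timeD]
  have e3 : ∫ s in (0 : ℝ)..r, ∫ u in Omega n, laplacian F u * phi a (ρ s u) =
      -(c * (eigVal i * ∫ q in (0 : ℝ)..r, coef i (fun u => phi a (R (q, u))))).re := by
    have h1 : ∀ q ∈ uIcc 0 r, ∫ u in Omega n, laplacian F u * phi a (ρ q u) =
        -eigVal i * (c * coef i (fun u => phi a (R (q, u)))).re := by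
      intro q hq
      rw [uIcc_of_le hr.le] at hq
      rw [← integral_prodFn_mul (hφ.section_right q), ← integral_const_mul]
      refine setIntegral_congr_fun measurableSet_Omega fun u hu => ?_
      have hu' := Omega_subset_OmegaBar hu
      rw [hF, laplacian_prodFn_axMode i c hu', hRρ q ⟨hq.1, hq.2.trans hrt⟩ u hu']
      ring
    have h2 := (Complex.reCLM).intervalIntegral_comp_comm
      ((intervalIntegrable_coef hφ i 0 r).const_mul c)
    simp only [Complex.reCLM_apply] at h2
    rw [intervalIntegral.integral_congr h1, intervalIntegral.integral_const_mul, h2,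
      intervalIntegral.integral_const_mul, mul_left_comm, Complex.re_ofReal_mul]
    ring
  simp only [e1, e2, e3, sub_zero] at hw
  rw [mul_add, mul_sub, Complex.add_re, Complex.sub_re]
  linarith

/-- A bounded measurable extension of a solution on a finite layer. -/
lemma IsWeakSolutionLayer.exists_extension {a : ℝ} {b ρ₀ : Cyl n → ℝ} {t : ℝ} {ρ : ℝ → Cyl n → ℝ}
    (h : IsWeakSolutionLayer a b ρ₀ t ρ) : ∃ R : ℝ × Cyl n → ℝ, BddMeas R ∧
      (∀ z, R z ∈ Icc (0 : ℝ) 1) ∧ ∀ r ∈ Icc 0 t, ∀ u ∈ OmegaBar n, R (r, u) = ρ r u := by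
  have hm : MeasurableSet (Icc 0 t ×ˢ OmegaBar n : Set (ℝ × Cyl n)) :=
    measurableSet_Icc.prod (measurable_fst measurableSet_Icc)
  set R := (Icc 0 t ×ˢ OmegaBar n).indicator (fun p : ℝ × Cyl n => ρ p.1 p.2) with hR
  have hmem : ∀ z, R z ∈ Icc (0 : ℝ) 1 := by
    intro z
    by_cases hz : z ∈ (Icc 0 t ×ˢ OmegaBar n : Set (ℝ × Cyl n))
    · rw [hR, indicator_of_mem hz]; exact h.range _ hz.1 _ hz.2
    · rw [hR, indicator_of_notMem hz]; simp
  refine ⟨R, ⟨?_, 1, fun z => ?_⟩, hmem, fun r hr u hu => indicator_of_mem (mk_mem_prod hr hu) _⟩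
  · refine measurable_of_restrict_of_restrict_compl hm ?_ ?_
    · convert h.meas using 1
      ext z
      exact (indicator_of_mem z.2 (fun p : ℝ × Cyl n => ρ p.1 p.2))
    · convert measurable_const (a := (0 : ℝ)) using 1
      ext z
      exact (indicator_of_notMem z.2 (fun p : ℝ × Cyl n => ρ p.1 p.2))
  · rw [abs_of_nonneg (hmem z).1]; exact (hmem z).2

/-- Ordered weak solutions stay ordered. -/
theorem IsWeakSolution.ae_le {a : ℝ} (ha : -1 / 2 < a) {b ρ₀₁ ρ₀₂ : Cyl n → ℝ} {T : EReal}
    {ρ₁ ρ₂ : ℝ → Cyl n → ℝ} (hρ₁ : IsWeakSolution a b ρ₀₁ T ρ₁)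
    (hρ₂ : IsWeakSolution a b ρ₀₂ T ρ₂) {s : ℝ} (hs : 0 ≤ s)
    (hle : ∀ᵐ u ∂(volume.restrict (Omega n)), ρ₁ s u ≤ ρ₂ s u) {t : ℝ} (hst : s ≤ t)
    (htT : (t : EReal) ≤ T) : ∀ᵐ u ∂(volume.restrict (Omega n)), ρ₁ t u ≤ ρ₂ t u := by
  -- For t = s there is nothing to prove; otherwise t > 0, as required of a layer.
  rcases hst.eq_or_lt with rfl | hlt
  · exact hle
  have ht : 0 < t := hs.trans_lt hlt
  obtain ⟨R₁, hR₁, hR₁m, hR₁ρ⟩ := (hρ₁.layer t ht htT).exists_extension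
  obtain ⟨R₂, hR₂, hR₂m, hR₂ρ⟩ := (hρ₂.layer t ht htT).exists_extension
  set w : ℝ × Cyl n → ℝ := fun z => R₁ z - R₂ z with hw
  set v : ℝ × Cyl n → ℝ := fun z => 1 + a * (R₁ z + R₂ z) with hv
  have hwb : BddMeas w := hR₁.sub hR₂
  have hvb : BddMeas v := (BddMeas.const 1).add ((hR₁.add hR₂).const_mul a)
  have hφ : ∀ {R : ℝ × Cyl n → ℝ}, BddMeas R → BddMeas fun z => phi a (R z) := fun hR =>
    hR.mul ((BddMeas.const 1).add (hR.const_mul a))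
  have hwρ : ∀ r ∈ Icc s t, ∀ u ∈ Omega n, w (r, u) = ρ₁ r u - ρ₂ r u := fun r hr u hu => by
    have hr' : r ∈ Icc 0 t := ⟨hs.trans hr.1, hr.2⟩
    simp only [hw]
    rw [hR₁ρ r hr' u (Omega_subset_OmegaBar hu), hR₂ρ r hr' u (Omega_subset_OmegaBar hu)]
  have hzero : ∀ i, ∀ r ∈ Icc 0 t, coef i (fun u => w (r, u)) - coef i (fun u => w (0, u)) +
      eigVal i * ∫ q in (0 : ℝ)..r, coef i (fun u => v (q, u) * w (q, u)) = 0 := by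
    intro i r hr
    rcases hr.1.eq_or_lt with rfl | hr0
    · simp
    have hI : ∫ q in (0 : ℝ)..r, coef i (fun u => v (q, u) * w (q, u)) =
        (∫ q in (0 : ℝ)..r, coef i (fun u => phi a (R₁ (q, u)))) -
          ∫ q in (0 : ℝ)..r, coef i (fun u => phi a (R₂ (q, u))) := by
      rw [← intervalIntegral.integral_sub (intervalIntegrable_coef (hφ hR₁) i _ _)
        (intervalIntegrable_coef (hφ hR₂) i _ _)]
      refine intervalIntegral.integral_congr fun q _ => ?_
      rw [← coef_sub ((hφ hR₁).section_right q) ((hφ hR₂).section_right q)]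
      congr 1
      ext u
      simp only [hv, hw, phi]
      ring
    -- The boundary flux depends only on a, b and the mode, so it cancels between the two solutions.
    -- The choices c = 1 and c = -i then give the real and imaginary parts.
    have hre : ∀ c : ℂ, (c * (coef i (fun u => w (r, u)) - coef i (fun u => w (0, u)) +
        eigVal i * ∫ q in (0 : ℝ)..r, coef i (fun u => v (q, u) * w (q, u)))).re = 0 := by
      intro c
      have h1 := hρ₁.mode_equation htT hR₁ hR₁ρ i c hr0 hr.2
      have h2 := hρ₂.mode_equation htT hR₂ hR₂ρ i c hr0 hr.2
      rw [hI]
      simp only [hw]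
      rw [coef_sub (hR₁.section_right r) (hR₂.section_right r),
        coef_sub (hR₁.section_right 0) (hR₂.section_right 0)]
      refine Eq.trans ?_ (sub_eq_zero.2 (h1.trans h2.symm))
      rw [← Complex.sub_re]
      congr 1
      ring
    refine Complex.ext ?_ ?_
    · simpa using hre 1
    · simpa using hre (-Complex.I)
  have hweq : ∀ i, ∀ r ∈ Icc s t, coef i (fun u => w (r, u)) = coef i (fun u => w (s, u)) -
      eigVal i * ∫ q in s..r, coef i (fun u => v (q, u) * w (q, u)) := by
    intro i r hr
    have h1 := hzero i r ⟨hs.trans hr.1, hr.2⟩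
    have h2 := hzero i s ⟨hs, hst⟩
    have hint := intervalIntegrable_coef (hvb.mul hwb) i
    rw [← intervalIntegral.integral_interval_sub_left (hint 0 r) (hint 0 s)]
    linear_combination h1 - h2
  have hvle : ∀ z, v z ≤ 1 + 2 * |a| := fun z => by
    have h1 := hR₁m z
    have h2 := hR₂m z
    have h3 : a * (R₁ z + R₂ z) ≤ |a| * 2 :=
      mul_le_mul (le_abs_self a) (by linarith [h1.2, h2.2]) (by linarith [h1.1, h2.1])
        (abs_nonneg a)
    simp only [hv]
    linarith
  -- Uniform ellipticity: R₁ + R₂ lies in [0, 2], and a > -1/2 makes this lower bound positive.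
  have hvge : ∀ z, min 1 (1 + 2 * a) ≤ v z := fun z => by
    have h1 := hR₁m z
    have h2 := hR₂m z
    simp only [hv]
    rcases le_total 0 a with h | h
    · exact (min_le_left _ _).trans (by nlinarith [h1.1, h2.1])
    · exact (min_le_right _ _).trans (by nlinarith [h1.2, h2.2])
  have hres := ae_nonpos_of_mode_equation hlt hvb hwb
    (lt_min one_pos (by linarith) : 0 < min 1 (1 + 2 * a)) hvge hvle hweq (by
      filter_upwards [hle, ae_restrict_mem measurableSet_Omega] with u hu hu2
      rw [hwρ s ⟨le_rfl, hst⟩ u hu2]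
      exact sub_nonpos.2 hu)
  filter_upwards [hres, ae_restrict_mem measurableSet_Omega] with u hu hu2
  rw [hwρ t ⟨hst, le_rfl⟩ u hu2] at hu
  exact sub_nonpos.1 hu

end

end Exclusion

theorem lemma6p4 (n : ℕ) (hn : 1 ≤ n) (a : ℝ) (ha : -1 / 2 < a)
    (b : Exclusion.Cyl n → ℝ) (hb : Exclusion.IsBoundaryDensity b)
    (T : EReal) (hT : 0 < T)
    (ρ₀₁ ρ₀₂ : Exclusion.Cyl n → ℝ)
    (hρ₀₁ : Exclusion.IsProfile ρ₀₁) (hρ₀₂ : Exclusion.IsProfile ρ₀₂)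
    (ρ₁ ρ₂ : ℝ → Exclusion.Cyl n → ℝ)
    (hρ₁ : Exclusion.IsWeakSolution a b ρ₀₁ T ρ₁)
    (hρ₂ : Exclusion.IsWeakSolution a b ρ₀₂ T ρ₂)
    (s : ℝ) (hs : 0 ≤ s)
    (hle : ∀ᵐ u ∂(MeasureTheory.volume.restrict (Exclusion.Omega n)), ρ₁ s u ≤ ρ₂ s u) :
    ∀ t : ℝ, s ≤ t → (t : EReal) ≤ T →
      ∀ᵐ u ∂(MeasureTheory.volume.restrict (Exclusion.Omega n)), ρ₁ t u ≤ ρ₂ t u := by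
  exact fun _ hst htT => hρ₁.ae_le ha hρ₂ hs hle hst htT
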